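/- **Setting.** Let $N\ge 2$ be an integer, $h=1/N$, and let $0<t<1$ with $t\ne h\beta$ for $\beta=0,1,\dots,N$. Integrals $\int_0^1\frac{\varphi(x)}{x-t}\,dx$ are Cauchy principal values. Let $L_2^{(2)}(0,1)$ be the space of (continuous representatives on $[0,1]$ of) real functions $\varphi$ with a generalized second derivative $\varphi''\in L_2(0,1)$, with the seminorm $\|\varphi\|=\left(\int_0^1|\varphi''(x)|^2dx\right)^{1/2}$. For $C=(C_0,\dots,C_N)\in\mathbb R^{N+1}$ let $$\ell_C(\varphi)=\int_0^1\frac{\varphi(x)}{x-t}\,dx-\sum_{\beta=0}^N C_\beta\,\varphi(h\beta),\qquad \|\ell_C\|=\sup_{\|\varphi\|\le 1}|\ell_C(\varphi)|\in[0,\infty].$$ The quadrature formula $\int_0^1\frac{\varphi(x)}{x-t}dx\cong\sum_{\beta=0}^N C_\beta\varphi(h\beta)$ is *optimal in the sense of Sard* if $\|\ell_C\|<\infty$ and $\|\ell_C\|\le\|\ell_{C'}\|$ for all $C'\in\mathbb R^{N+1}$. **Notation.** Put $q=\sqrt3-2$, $$f(y,t)=\tfrac1{12}\Big(-\tfrac{11}{3}y^3+(5t+3)y^2-\big(2t^2+3t+\tfrac32\big)y+t^2+\tfrac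 t2+\tfrac13+(t-y)^3\big(-2\ln|y-t|+\ln(t-t^2)\big)\Big),$$ $$g_0=\ln\tfrac{1-t}{t},\qquad g_1=1+t\ln\tfrac{1-t}{t},$$ $$A_1=3q+2,\quad A_2=h(2q+1),\quad A_3=h^2q,\quad B_1=3q^N(3q+1),\quad B_2=hq^N(2q+1),\quad B_3=-h^2q^{N+1},$$ $$F_1=6(q+2)\sum_{\gamma=1}^Nq^{\gamma+1}f(h\gamma,t)-(12q+5)f(0,t),\qquad F_2=6(q+2)\sum_{\gamma=0}^{N-1}q^{N+1-\gamma}f(h\gamma,t)-(12q+5)f(1,t),$$ $$R_1=-F_1-\tfrac{g_0}{12}(B_1+3B_2+3B_3)+\tfrac{g_1}{4}(B_1+2B_2+B_3-A_3)-A_1f(0,t)-B_1\big(f(1,t)-\tfrac{g_0}{12}+\tfrac{g_1}{4}\big),$$ $$R_2=-F_2-\tfrac{g_0}{12}(A_1+3A_2+3A_3)+\tfrac{g_1}{4}(A_1+2A_2+A_3-B_3)-B_1f(0,t)-A_1\big(f(1,t)-\tfrac{g_0}{12}+\tfrac{g_1}{4}\big),$$ $$\Delta=B_2^2-A_2^2,\qquad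 \Delta_1=A_2R_1-B_2R_2,\qquad \Delta_2=-A_2R_2+B_2R_1,$$ $$a_1^-=\frac{\Delta_1}{\Delta},\qquad a_1^+=\frac{\Delta_2}{\Delta},\qquad a_0^-=f(0,t),\qquad a_0^+=f(1,t)-\tfrac1{12}g_0+\tfrac14g_1-\frac{\Delta_2}{\Delta}.$$ **Theorem 1.** The principal value $\int_0^1\frac{\varphi(x)}{x-t}dx$ exists for every $\varphi\in L_2^{(2)}(0,1)$; moreover $f(h\beta,t)=\frac1{12}\int_0^1\frac{|x-h\beta|^3}{x-t}dx$ for $\beta=0,\dots,N$, $g_0=\int_0^1\frac{dx}{x-t}$, $g_1=\int_0^1\frac{x\,dx}{x-t}$, and $\Delta\ne0$. (i) There is exactly one Sard-optimal formula, and its coefficients $C_\beta=C([\beta],t)$ are $$\begin{aligned}C([0],t)=\frac6{h^3}\Big[&\tfrac{g_0}{12}\big(h^3-3q^N(h^2+h(q+2))\big)+\tfrac{g_1q^N}{4}\big(h^2+2h(q+2)\big)+a_1^-h(q+1)+f(0,t)(3q+2)\\&-f(h,t)(12q+5)-q^N\big(3f(1,t)(q+1)+a_1^+h(q+2)\big)+6(q+2)\sum_{\gamma=2}^Nq^\gamma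 f(h\gamma,t)\Big],\end{aligned}$$ for $1\le\beta\le N-1$: $$\begin{aligned}C([\beta],t)=\frac6{h^3}\Big[&6(q+2)\sum_{\gamma=0}^{\beta-2}q^{\beta-\gamma}f(h\gamma,t)-(12q+5)\big(f(h(\beta-1),t)+f(h(\beta+1),t)\big)+(6q+4)f(h\beta,t)\\&+6(q+2)\sum_{\gamma=\beta+2}^Nq^{\gamma-\beta}f(h\gamma,t)+\tfrac{g_1}{4}\big(q^{N-\beta}(2h(q+2)+h^2)-q^\beta h^2\big)\\&+q^\beta\big(a_1^-h(q+2)-3f(0,t)(q+1)\big)-q^{N-\beta}\big(3f(1,t)(q+1)+\tfrac{g_0}{4}(h(q+2)+h^2)+a_1^+h(q+2)\big)\Big],\end{aligned}$$ $$\begin{aligned}C([N],t)=\frac6{h^3}\Big[&-\tfrac{g_0}{12}\big(3h(q+1)-h^3\big)+\tfrac{g_1}{4}\big(2h(q+1)-q^Nh^2\big)+q^N\big(a_1^-h(q+2)-3f(0,t)(q+1)\big)-a_1^+h(q+1)\\&+f(1,t)(3q+2)-f(1-h,t)(12q+5)+6(q+2)\sum_{\gamma=0}^{N-2}q^{N-\gamma}f(h\gamma,t)\Big]\end{aligned}$$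 (empty sums are $0$). (ii) The linear system in the unknowns $C_0,\dots,C_N,p_1,p_0$ $$\sum_{\gamma=0}^NC_\gamma\frac{|h\beta-h\gamma|^3}{12}+p_1h\beta+p_0=f(h\beta,t)\quad(\beta=0,\dots,N),\qquad\sum_{\gamma=0}^NC_\gamma=g_0,\qquad\sum_{\gamma=0}^NC_\gamma h\gamma=g_1$$ has exactly one solution, namely $C_\beta=C([\beta],t)$ from (i) with $p_1=\frac12(a_1^-+a_1^+)$ and $p_0=\frac12(a_0^-+a_0^+)$. For this solution the function $u(y)=\sum_{\gamma=0}^NC_\gamma\frac{|y-h\gamma|^3}{12}+p_1y+p_0$ satisfies, for all integers $k$, $$u(hk)=-\tfrac1{12}(hk)^3g_0+\tfrac14(hk)^2g_1+a_1^-\,hk+a_0^-\quad(k\le0),\qquad u(hk)=\tfrac1{12}(hk)^3g_0-\tfrac14(hk)^2g_1+a_1^+\,hk+a_0^+\quad(k\ge N).$$ -/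

import Mathlib

open Set Filter Topology MeasureTheory
open scoped ENNReal ContDiff

namespace CauchyQuad

noncomputable section

/-! ### The singular integral and the Sobolev space -/

/-- The integral of `φ x / (x - t)` over `(0,1)` without the interval `(t - ε, t + ε)`. -/
def truncatedIntegral (φ : ℝ → ℝ) (t ε : ℝ) : ℝ :=
  (∫ x in (0 : ℝ)..(t - ε), φ x / (x - t)) + ∫ x in (t + ε)..(1 : ℝ), φ x / (x - t)

/-- The Cauchy type singular integral of `φ x / (x - t)` over `(0,1)` exists, as a principal value,
and equals `I`. -/
def HasSingularIntegral (φ : ℝ → ℝ) (t I : ℝ) : Prop :=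
  Tendsto (truncatedIntegral φ t) (𝓝[>] (0 : ℝ)) (𝓝 I)

/-- The value of the Cauchy type singular integral (a principal value). -/
def singularIntegral (φ : ℝ → ℝ) (t : ℝ) : ℝ :=
  limUnder (𝓝[>] (0 : ℝ)) (truncatedIntegral φ t)

/-- `g` is the generalized second derivative of `φ` on the interval `(0,1)`. -/
def IsWeakSecondDeriv (φ g : ℝ → ℝ) : Prop :=
  ∀ ψ : ℝ → ℝ, ContDiff ℝ ∞ ψ → HasCompactSupport ψ → tsupport ψ ⊆ Ioo (0 : ℝ) 1 →
    ∫ x in Ioo (0 : ℝ) 1, φ x * iteratedDeriv 2 ψ x = ∫ x in Ioo (0 : ℝ) 1, g x * ψ x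

/-- `φ` belongs to the Sobolev space of functions on `(0,1)` with a square integrable generalized
second derivative `g`; as point values are used, `φ` is the continuous representative on `[0,1]`. -/
structure MemSobolevWith (φ g : ℝ → ℝ) : Prop where
  continuousOn : ContinuousOn φ (Icc (0 : ℝ) 1)
  memLp : MemLp g 2 (volume.restrict (Ioo (0 : ℝ) 1))
  weakDeriv : IsWeakSecondDeriv φ g

/-! ### Quadrature formulas with equally spaced nodes and their optimality -/

/-- The step `h = 1 / N`. -/
def step (N : ℕ) : ℝ := 1 / (N : ℝ)

/-- The error functional of the quadrature formula with coefficients `C` and nodes `hβ`. -/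
def quadError (N : ℕ) (t : ℝ) (C : Fin (N + 1) → ℝ) (φ : ℝ → ℝ) : ℝ :=
  singularIntegral φ t - ∑ β : Fin (N + 1), C β * φ (step N * (β : ℕ))

/-- The norm of the error functional on the Sobolev space with the (semi)norm
`‖φ‖ = (∫₀¹ |φ''|²)^(1/2)`; it is `∞` if the functional is not bounded. -/
def errorNorm (N : ℕ) (t : ℝ) (C : Fin (N + 1) → ℝ) : ℝ≥0∞ :=
  ⨆ (φ : ℝ → ℝ) (g : ℝ → ℝ) (_ : MemSobolevWith φ g)
    (_ : eLpNorm g 2 (volume.restrict (Ioo (0 : ℝ) 1)) ≤ 1), ENNReal.ofReal |quadError N t C φ|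

/-- Optimality in the sense of Sard: for the given nodes, `C` minimizes the (finite) norm of the
error functional among all coefficient vectors. -/
def IsSardOptimal (N : ℕ) (t : ℝ) (C : Fin (N + 1) → ℝ) : Prop :=
  errorNorm N t C < ⊤ ∧ ∀ C' : Fin (N + 1) → ℝ, errorNorm N t C ≤ errorNorm N t C'

/-! ### The right-hand sides and the linear system -/

/-- The function `f(y,t)`, in closed form. -/
def f (y t : ℝ) : ℝ :=
  (1 / 12) * (-(11 / 3) * y ^ 3 + (5 * t + 3) * y ^ 2 - (2 * t ^ 2 + 3 * t + 3 / 2) * y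
    + (t ^ 2 + t / 2 + 1 / 3)
    + (t - y) ^ 3 * (-2 * Real.log |y - t| + Real.log (t - t ^ 2)))

def g₀ (t : ℝ) : ℝ := Real.log ((1 - t) / t)

def g₁ (t : ℝ) : ℝ := 1 + t * Real.log ((1 - t) / t)

/-- The function `u(y) = ∑ γ, C γ * |y - hγ| ^ 3 / 12 + p₁ * y + p₀`. -/
def u (N : ℕ) (C : Fin (N + 1) → ℝ) (p₁ p₀ y : ℝ) : ℝ :=
  (∑ γ : Fin (N + 1), C γ * (|y - step N * (γ : ℕ)| ^ 3 / 12)) + p₁ * y + p₀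

/-- The linear system for the coefficients `C` and the numbers `p₁`, `p₀`. -/
structure SolvesSystem (N : ℕ) (t : ℝ) (C : Fin (N + 1) → ℝ) (p₁ p₀ : ℝ) : Prop where
  eq_f : ∀ β : Fin (N + 1), u N C p₁ p₀ (step N * (β : ℕ)) = f (step N * (β : ℕ)) t
  eq_g₀ : ∑ γ : Fin (N + 1), C γ = g₀ t
  eq_g₁ : ∑ γ : Fin (N + 1), C γ * (step N * (γ : ℕ)) = g₁ t

/-! ### The explicit formulas -/

def q : ℝ := √3 - 2

def A₁ : ℝ := 3 * q + 2

def A₂ (N : ℕ) : ℝ := step N * (2 * q + 1)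

def A₃ (N : ℕ) : ℝ := step N ^ 2 * q

def B₁ (N : ℕ) : ℝ := 3 * q ^ N * (3 * q + 1)

def B₂ (N : ℕ) : ℝ := step N * q ^ N * (2 * q + 1)

def B₃ (N : ℕ) : ℝ := -(step N ^ 2 * q ^ (N + 1))

def F₁ (N : ℕ) (t : ℝ) : ℝ :=
  6 * (q + 2) * (∑ γ ∈ Finset.Icc 1 N, q ^ (γ + 1) * f (step N * γ) t) - (12 * q + 5) * f 0 t

def F₂ (N : ℕ) (t : ℝ) : ℝ :=
  6 * (q + 2) * (∑ γ ∈ Finset.Icc 0 (N - 1), q ^ (N + 1 - γ) * f (step N * γ) t)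
    - (12 * q + 5) * f 1 t

/-- The first bracket occurring in `Δ₁` and `Δ₂`. -/
def R₁ (N : ℕ) (t : ℝ) : ℝ :=
  -F₁ N t - (1 / 12) * g₀ t * (B₁ N + 3 * B₂ N + 3 * B₃ N)
    + (1 / 4) * g₁ t * (B₁ N + 2 * B₂ N + B₃ N - A₃ N)
    - A₁ * f 0 t - B₁ N * (f 1 t - (1 / 12) * g₀ t + (1 / 4) * g₁ t)

/-- The second bracket occurring in `Δ₁` and `Δ₂`. -/
def R₂ (N : ℕ) (t : ℝ) : ℝ :=
  -F₂ N t - (1 / 12) * g₀ t * (A₁ + 3 * A₂ N + 3 * A₃ N)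
    + (1 / 4) * g₁ t * (A₁ + 2 * A₂ N + A₃ N - B₃ N)
    - B₁ N * f 0 t - A₁ * (f 1 t - (1 / 12) * g₀ t + (1 / 4) * g₁ t)

def Δ (N : ℕ) : ℝ := B₂ N ^ 2 - A₂ N ^ 2

def Δ₁ (N : ℕ) (t : ℝ) : ℝ := A₂ N * R₁ N t - B₂ N * R₂ N t

def Δ₂ (N : ℕ) (t : ℝ) : ℝ := -(A₂ N * R₂ N t) + B₂ N * R₁ N t

def a₁neg (N : ℕ) (t : ℝ) : ℝ := Δ₁ N t / Δ N

def a₁pos (N : ℕ) (t : ℝ) : ℝ := Δ₂ N t / Δ N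

def a₀neg (t : ℝ) : ℝ := f 0 t

def a₀pos (N : ℕ) (t : ℝ) : ℝ :=
  f 1 t - (1 / 12) * g₀ t + (1 / 4) * g₁ t - Δ₂ N t / Δ N

/-- The coefficient at the node `0`. -/
def coeffFirst (N : ℕ) (t : ℝ) : ℝ :=
  let h := step N
  6 / h ^ 3 *
    (g₀ t / 12 * (h ^ 3 - 3 * q ^ N * (h ^ 2 + h * (q + 2)))
      + g₁ t * q ^ N / 4 * (h ^ 2 + 2 * h * (q + 2))
      + a₁neg N t * h * (q + 1) + f 0 t * (3 * q + 2) - f h t * (12 * q + 5)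
      - q ^ N * (3 * f 1 t * (q + 1) + a₁pos N t * h * (q + 2))
      + 6 * (q + 2) * (∑ γ ∈ Finset.Icc 2 N, q ^ γ * f (h * γ) t))

/-- The coefficient at the node `hβ`, for `1 ≤ β ≤ N - 1`; the first sum is over
`0 ≤ γ ≤ β - 2` (empty for `β = 1`). -/
def coeffMiddle (N : ℕ) (t : ℝ) (β : ℕ) : ℝ :=
  let h := step N
  6 / h ^ 3 *
    (6 * (q + 2) * (∑ γ ∈ Finset.range (β - 1), q ^ (β - γ) * f (h * γ) t)
      - (12 * q + 5) * (f (h * ((β : ℝ) - 1)) t + f (h * ((β : ℝ) + 1)) t)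
      + (6 * q + 4) * f (h * β) t
      + 6 * (q + 2) * (∑ γ ∈ Finset.Icc (β + 2) N, q ^ (γ - β) * f (h * γ) t)
      + g₁ t / 4 * (q ^ (N - β) * (2 * h * (q + 2) + h ^ 2) - q ^ β * h ^ 2)
      + q ^ β * (a₁neg N t * h * (q + 2) - 3 * f 0 t * (q + 1))
      - q ^ (N - β) * (3 * f 1 t * (q + 1) + g₀ t / 4 * (h * (q + 2) + h ^ 2)
          + a₁pos N t * h * (q + 2)))

/-- The coefficient at the node `1`; the sum is over `0 ≤ γ ≤ N - 2`. -/
def coeffLast (N : ℕ) (t : ℝ) : ℝ :=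
  let h := step N
  6 / h ^ 3 *
    (-(g₀ t / 12 * (3 * h * (q + 1) - h ^ 3))
      + g₁ t / 4 * (2 * h * (q + 1) - q ^ N * h ^ 2)
      + q ^ N * (a₁neg N t * h * (q + 2) - 3 * f 0 t * (q + 1))
      - a₁pos N t * h * (q + 1) + f 1 t * (3 * q + 2) - f (1 - h) t * (12 * q + 5)
      + 6 * (q + 2) * (∑ γ ∈ Finset.range (N - 1), q ^ (N - γ) * f (h * γ) t))

/-- The vector of the explicit coefficients. -/
def coeff (N : ℕ) (t : ℝ) (β : Fin (N + 1)) : ℝ :=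
  if (β : ℕ) = 0 then coeffFirst N t
  else if (β : ℕ) = N then coeffLast N t
  else coeffMiddle N t β

end

end CauchyQuad

/-!
By Taylor's formula with integral remainder, an error functional that vanishes on affine functions
pairs `φ''` in `L²(0,1)` with its Peano kernel, and it is unbounded otherwise. Its norm is therefore
the `L²` norm of the kernel, so the optimal formula is the one whose kernel is orthogonal to the
kernels of all admissible perturbations. Orthogonality means that the difference of `f` and a
cubic spline is affine on the nodes, which is the linear system.

Extend the nodal values of `f` to the grid `hℤ` by the two cubics with coefficients `a₁neg`,
`a₀neg` and `a₁pos`, `a₀pos`. The fourth difference of `|y| ^ 3` is a multiple of the operator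
`v k ↦ v (k - 1) + 4 * v k + v (k + 1)`, whose Green's function is `q ^ |k| / (2 * (q + 2))`,
because `q` is a root of `x ^ 2 + 4 * x + 1`. Convolving with it gives coefficients for which `u`
has the same fourth differences as the extended values, so the two differ by a cubic `D` on all of
`hℤ`. The outer cubics are chosen such that to the right of `1` they differ by `-D` as well. Hence
`D = 0`, which is the linear system.
-/

namespace CauchyQuad

/-! ### Principal values -/

section PrincipalValue

variable {φ χ ρ : ℝ → ℝ} {t I : ℝ}

theorem eventually_pos_lt_lt (ht₀ : 0 < t) (ht₁ : t < 1) :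
    ∀ᶠ ε in 𝓝[>] (0 : ℝ), 0 < ε ∧ ε < t ∧ ε < 1 - t := by
  filter_upwards [Ioo_mem_nhdsGT (lt_min ht₀ (sub_pos.2 ht₁))] with ε hε
  exact ⟨hε.1, lt_min_iff.1 hε.2⟩

theorem HasSingularIntegral.singularIntegral_eq (h : HasSingularIntegral φ t I) :
    singularIntegral φ t = I :=
  h.limUnder_eq

theorem HasSingularIntegral.congr (ht₀ : 0 < t) (ht₁ : t < 1) (h : HasSingularIntegral φ t I)
    (heq : EqOn φ χ (Icc 0 1)) : HasSingularIntegral χ t I := by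
  refine Tendsto.congr' ?_ h
  filter_upwards [eventually_pos_lt_lt ht₀ ht₁] with ε ⟨hε₀, hεt, hεt'⟩
  unfold truncatedIntegral
  congr 1 <;> refine intervalIntegral.integral_congr fun x hx => ?_ <;>
    rw [uIcc_of_le (by linarith)] at hx <;>
    exact congrArg (· / (x - t)) (heq ⟨by linarith [hx.1], by linarith [hx.2]⟩)

theorem HasSingularIntegral.comp_one_sub (h : HasSingularIntegral φ t I) :
    HasSingularIntegral (fun x => φ (1 - x)) (1 - t) (-I) := by
  refine h.neg.congr fun ε => ?_
  have hquot : ∀ x, φ (1 - x) / (x - (1 - t)) = -(φ (1 - x) / (1 - x - t)) := fun x => by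
    rw [← div_neg]
    ring_nf
  simp only [truncatedIntegral, hquot, intervalIntegral.integral_neg,
    intervalIntegral.integral_comp_sub_left fun x => φ x / (x - t)]
  rw [sub_zero, sub_self, show 1 - (1 - t - ε) = t + ε by ring,
    show 1 - (1 - t + ε) = t - ε by ring, neg_add_rev]

theorem integral_sub_inv_left {ε : ℝ} (ht₀ : 0 < t) (hε : 0 < ε) :
    ∫ x in (0 : ℝ)..(t - ε), (x - t)⁻¹ = Real.log (ε / t) := by
  rw [intervalIntegral.integral_comp_sub_right (fun x => x⁻¹) t,
    integral_inv_of_neg (by linarith) (by linarith), sub_sub_cancel_left, zero_sub,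
    neg_div_neg_eq]

theorem integral_sub_inv_right {ε : ℝ} (ht₁ : t < 1) (hε : 0 < ε) :
    ∫ x in (t + ε)..(1 : ℝ), (x - t)⁻¹ = Real.log ((1 - t) / ε) := by
  rw [intervalIntegral.integral_comp_sub_right (fun x => x⁻¹) t,
    integral_inv_of_pos (by linarith) (by linarith), add_sub_cancel_left]

theorem intervalIntegrable_sub_inv {a b : ℝ} (h : t ∉ uIcc a b) :
    IntervalIntegrable (fun x => (x - t)⁻¹) volume a b := by
  refine (ContinuousOn.inv₀ (by fun_prop) fun x hx hxt => h ?_).intervalIntegrable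
  rwa [← sub_eq_zero.1 hxt]

theorem integral_div_sub {a b : ℝ} (h : t ∉ uIcc a b)
    (hφ : IntervalIntegrable (slope φ t) volume a b) :
    ∫ x in a..b, φ x / (x - t) =
      (∫ x in a..b, slope φ t x) + φ t * ∫ x in a..b, (x - t)⁻¹ := by
  rw [← intervalIntegral.integral_const_mul,
    ← intervalIntegral.integral_add hφ ((intervalIntegrable_sub_inv h).const_mul _)]
  refine intervalIntegral.integral_congr fun x _ => ?_
  simp only [slope_def_field]
  ring

theorem log_add_log_eq_g₀ {ε : ℝ} (ht₀ : 0 < t) (ht₁ : t < 1) (hε : 0 < ε) :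
    Real.log (ε / t) + Real.log ((1 - t) / ε) = g₀ t := by
  have ht₁' : 1 - t ≠ 0 := (sub_pos.2 ht₁).ne'
  rw [g₀, ← Real.log_mul (by positivity) (by positivity)]
  congr 1
  field_simp

theorem truncatedIntegral_eq {ε : ℝ} (ht₀ : 0 < t) (ht₁ : t < 1)
    (hφ : IntervalIntegrable (slope φ t) volume 0 1) (hε : 0 < ε ∧ ε < t ∧ ε < 1 - t) :
    truncatedIntegral φ t ε =
      (∫ x in (0 : ℝ)..(t - ε), slope φ t x) + (∫ x in (t + ε)..(1 : ℝ), slope φ t x)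
        + φ t * g₀ t := by
  obtain ⟨hε₀, hεt, hεt'⟩ := hε
  have hleft : uIcc 0 (t - ε) = Icc 0 (t - ε) := uIcc_of_le (by linarith)
  have hright : uIcc (t + ε) 1 = Icc (t + ε) 1 := uIcc_of_le (by linarith)
  have h01 : uIcc (0 : ℝ) 1 = Icc 0 1 := uIcc_of_le zero_le_one
  rw [truncatedIntegral, integral_div_sub, integral_div_sub, integral_sub_inv_left ht₀ hε₀,
    integral_sub_inv_right ht₁ hε₀, ← log_add_log_eq_g₀ ht₀ ht₁ hε₀]
  · ring
  · exact fun ht => by linarith [(hright ▸ ht).1]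
  · exact hφ.mono_set (by rw [hright, h01]; exact Icc_subset_Icc_left (by linarith))
  · exact fun ht => by linarith [(hleft ▸ ht).2]
  · exact hφ.mono_set (by rw [hleft, h01]; exact Icc_subset_Icc_right (by linarith))

theorem tendsto_truncated_integral (ht₀ : 0 < t) (ht₁ : t < 1)
    (hρ : IntervalIntegrable ρ volume 0 1) :
    Tendsto (fun ε => (∫ x in (0 : ℝ)..(t - ε), ρ x) + ∫ x in (t + ε)..(1 : ℝ), ρ x)
      (𝓝[>] (0 : ℝ)) (𝓝 (∫ x in (0 : ℝ)..1, ρ x)) := by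
  have hcont {a : ℝ} (ha : a ∈ Icc (0 : ℝ) 1) :
      ContinuousAt (fun y => ∫ x in a..y, ρ x) t := by
    refine (intervalIntegral.continuousOn_primitive_interval' hρ ?_).continuousAt ?_
    · rwa [uIcc_of_le zero_le_one]
    · simpa only [uIcc_of_le (zero_le_one' ℝ)] using Icc_mem_nhds ht₀ ht₁
  have hsub : Tendsto (fun ε => t - ε) (𝓝[>] (0 : ℝ)) (𝓝 t) :=
    (by simpa using (continuous_sub_left t).tendsto 0 :
      Tendsto (fun ε => t - ε) (𝓝 0) (𝓝 t)).mono_left nhdsWithin_le_nhds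
  have hadd : Tendsto (fun ε => t + ε) (𝓝[>] (0 : ℝ)) (𝓝 t) :=
    (by simpa using (continuous_const_add t).tendsto 0 :
      Tendsto (fun ε => t + ε) (𝓝 0) (𝓝 t)).mono_left nhdsWithin_le_nhds
  have ht : t ∈ uIcc (0 : ℝ) 1 := by rw [uIcc_of_le zero_le_one]; exact ⟨ht₀.le, ht₁.le⟩
  rw [← intervalIntegral.integral_add_adjacent_intervals
    (hρ.mono_set (uIcc_subset_uIcc_left ht)) (hρ.mono_set (uIcc_subset_uIcc_right ht)),
    intervalIntegral.integral_symm 1 t]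
  refine (((hcont (left_mem_Icc.2 zero_le_one)).tendsto.comp hsub).add
    ((hcont (right_mem_Icc.2 zero_le_one)).tendsto.comp hadd).neg).congr fun ε => ?_
  simp only [Function.comp_apply, intervalIntegral.integral_symm 1 (t + ε)]

theorem hasSingularIntegral_of_slope (ht₀ : 0 < t) (ht₁ : t < 1)
    (hφ : IntervalIntegrable (slope φ t) volume 0 1) :
    HasSingularIntegral φ t ((∫ x in (0 : ℝ)..1, slope φ t x) + φ t * g₀ t) := by
  refine ((tendsto_truncated_integral ht₀ ht₁ hφ).add_const _).congr' ?_
  filter_upwards [eventually_pos_lt_lt ht₀ ht₁] with ε hε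
  exact (truncatedIntegral_eq ht₀ ht₁ hφ hε).symm

theorem hasSingularIntegral_one (ht₀ : 0 < t) (ht₁ : t < 1) :
    HasSingularIntegral (fun _ => 1) t (g₀ t) := by
  have hslope : slope (fun _ => (1 : ℝ)) t = fun _ => 0 := by
    ext x
    simp [slope_def_field]
  simpa [hslope] using hasSingularIntegral_of_slope (φ := fun _ => 1) ht₀ ht₁ (by simp [hslope])

end PrincipalValue

/-! ### The closed form of `f` -/

section AbsCubed

variable {t y : ℝ}

theorem f_one_sub (y t : ℝ) : f (1 - y) (1 - t) = -f y t := by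
  rw [f, f, show 1 - y - (1 - t) = -(y - t) by ring, abs_neg,
    show 1 - t - (1 - t) ^ 2 = t - t ^ 2 by ring]
  ring

theorem slope_abs_cubed_of_ge {x : ℝ} (hyt : y ≤ t) (hyx : y ≤ x) (hxt : x ≠ t) :
    slope (fun x => |x - y| ^ 3) t x = (x - y) ^ 2 + (x - y) * (t - y) + (t - y) ^ 2 := by
  rw [slope_def_field, div_eq_iff (sub_ne_zero.2 hxt), abs_of_nonneg (sub_nonneg.2 hyx),
    abs_of_nonneg (sub_nonneg.2 hyt)]
  ring

theorem slope_abs_cubed_of_le {x : ℝ} (hyt : y ≤ t) (hxy : x ≤ y) (hxt : x ≠ t) :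
    slope (fun x => |x - y| ^ 3) t x =
      -((x - y) ^ 2 + (x - y) * (t - y) + (t - y) ^ 2 + 2 * ((t - y) ^ 3 * (x - t)⁻¹)) := by
  have hxt' : x - t ≠ 0 := sub_ne_zero.2 hxt
  rw [slope_def_field, abs_of_nonpos (sub_nonpos.2 hxy), abs_of_nonneg (sub_nonneg.2 hyt)]
  field_simp
  ring

theorem integral_sq_add_mul_add_sq (y t a b : ℝ) :
    ∫ x in a..b, ((x - y) ^ 2 + (x - y) * (t - y) + (t - y) ^ 2) =
      ((b - y) ^ 3 / 3 + (b - y) ^ 2 / 2 * (t - y) + (t - y) ^ 2 * b) -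
        ((a - y) ^ 3 / 3 + (a - y) ^ 2 / 2 * (t - y) + (t - y) ^ 2 * a) := by
  refine intervalIntegral.integral_eq_sub_of_hasDerivAt
    (f := fun x => (x - y) ^ 3 / 3 + (x - y) ^ 2 / 2 * (t - y) + (t - y) ^ 2 * x)
    (fun x _ => ?_) (Continuous.intervalIntegrable (by fun_prop) _ _)
  have h := (hasDerivAt_id x).sub_const y
  refine ((((h.pow 3).div_const 3).add (((h.pow 2).div_const 2).mul_const (t - y))).add
    ((hasDerivAt_id x).const_mul ((t - y) ^ 2))).congr_deriv ?_
  simp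

theorem intervalIntegrable_cubed_mul_inv (hy₀ : 0 ≤ y) (hyt : y ≤ t) :
    IntervalIntegrable (fun x => (t - y) ^ 3 * (x - t)⁻¹) volume 0 y := by
  rcases hyt.eq_or_lt with rfl | hyt
  · simp
  · refine (intervalIntegrable_sub_inv fun ht => ?_).const_mul _
    rw [uIcc_of_le hy₀] at ht
    exact hyt.not_ge ht.2

theorem integral_cubed_mul_inv (hy₀ : 0 ≤ y) (hyt : y ≤ t) :
    ∫ x in (0 : ℝ)..y, (t - y) ^ 3 * (x - t)⁻¹ =
      (t - y) ^ 3 * (Real.log |y - t| - Real.log t) := by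
  rcases hyt.eq_or_lt with rfl | hyt
  · simp
  · have hty : 0 < t - y := sub_pos.2 hyt
    have hinv := integral_sub_inv_left (hy₀.trans_lt hyt) hty
    rw [sub_sub_cancel] at hinv
    rw [intervalIntegral.integral_const_mul, hinv, Real.log_div hty.ne' (hy₀.trans_lt hyt).ne',
      abs_sub_comm, abs_of_pos hty]

theorem slope_abs_cubed_ae_left (hy₀ : 0 ≤ y) (hyt : y ≤ t) :
    ∀ᵐ x, x ∈ uIoc 0 y → -((x - y) ^ 2 + (x - y) * (t - y) + (t - y) ^ 2
      + 2 * ((t - y) ^ 3 * (x - t)⁻¹)) = slope (fun x => |x - y| ^ 3) t x := by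
  filter_upwards [Measure.ae_ne volume t] with x hxt hx
  exact (slope_abs_cubed_of_le hyt (uIoc_of_le hy₀ ▸ hx).2 hxt).symm

theorem slope_abs_cubed_ae_right (hy₁ : y ≤ 1) (hyt : y ≤ t) :
    ∀ᵐ x, x ∈ uIoc y 1 → (x - y) ^ 2 + (x - y) * (t - y) + (t - y) ^ 2 =
      slope (fun x => |x - y| ^ 3) t x := by
  filter_upwards [Measure.ae_ne volume t] with x hxt hx
  exact (slope_abs_cubed_of_ge hyt (uIoc_of_le hy₁ ▸ hx).1.le hxt).symm

theorem twelve_mul_f (ht₀ : 0 < t) (ht₁ : t < 1) :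
    12 * f y t = -(11 / 3) * y ^ 3 + (5 * t + 3) * y ^ 2 - (2 * t ^ 2 + 3 * t + 3 / 2) * y
      + (t ^ 2 + t / 2 + 1 / 3)
      + (t - y) ^ 3 * (g₀ t - 2 * (Real.log |y - t| - Real.log t)) := by
  rw [f, g₀, Real.log_div (sub_pos.2 ht₁).ne' ht₀.ne', show t - t ^ 2 = t * (1 - t) by ring,
    Real.log_mul ht₀.ne' (sub_pos.2 ht₁).ne']
  ring

theorem hasSingularIntegral_abs_cubed_of_le (hy₀ : 0 ≤ y) (hyt : y ≤ t) (ht₀ : 0 < t)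
    (ht₁ : t < 1) : HasSingularIntegral (fun x => |x - y| ^ 3) t (12 * f y t) := by
  have hy₁ : y ≤ 1 := hyt.trans ht₁.le
  have hQ : ∀ a b, IntervalIntegrable
      (fun x => (x - y) ^ 2 + (x - y) * (t - y) + (t - y) ^ 2) volume a b := fun a b =>
    Continuous.intervalIntegrable (by fun_prop) a b
  have hinv := (intervalIntegrable_cubed_mul_inv hy₀ hyt).const_mul 2
  have hleft := slope_abs_cubed_ae_left hy₀ hyt
  have hright := slope_abs_cubed_ae_right hy₁ hyt
  have hint₁ := ((hQ 0 y).add hinv).neg.congr_ae ((ae_restrict_iff' measurableSet_uIoc).2 hleft)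
  have hint₂ := (hQ y 1).congr_ae ((ae_restrict_iff' measurableSet_uIoc).2 hright)
  convert hasSingularIntegral_of_slope ht₀ ht₁ (hint₁.trans hint₂) using 1
  rw [← intervalIntegral.integral_add_adjacent_intervals hint₁ hint₂,
    ← intervalIntegral.integral_congr_ae hleft, ← intervalIntegral.integral_congr_ae hright,
    intervalIntegral.integral_neg, intervalIntegral.integral_add (hQ 0 y) hinv,
    intervalIntegral.integral_const_mul, integral_cubed_mul_inv hy₀ hyt,
    integral_sq_add_mul_add_sq, integral_sq_add_mul_add_sq, twelve_mul_f ht₀ ht₁,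
    abs_of_nonneg (sub_nonneg.2 hyt)]
  ring

theorem hasSingularIntegral_abs_cubed (hy : y ∈ Icc (0 : ℝ) 1) (ht₀ : 0 < t) (ht₁ : t < 1) :
    HasSingularIntegral (fun x => |x - y| ^ 3) t (12 * f y t) := by
  rcases le_total y t with hyt | hty
  · exact hasSingularIntegral_abs_cubed_of_le hy.1 hyt ht₀ ht₁
  · convert (hasSingularIntegral_abs_cubed_of_le (y := 1 - y) (t := 1 - t) (sub_nonneg.2 hy.2)
      (sub_le_sub_left hty 1) (sub_pos.2 ht₁) (sub_lt_self 1 ht₀)).comp_one_sub using 1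
    · ext x
      rw [sub_sub_sub_cancel_left, abs_sub_comm]
    · rw [sub_sub_cancel]
    · rw [f_one_sub, mul_neg, neg_neg]

end AbsCubed

/-! ### Test functions and the lemma of du Bois-Reymond -/

section TestFunctions

variable {a b : ℝ} {ψ χ w : ℝ → ℝ}

/-- The space of smooth functions with compact support in `(a,b)`, against which generalized
derivatives are tested. -/
def testFunctions (a b : ℝ) : Submodule ℝ (ℝ → ℝ) where
  carrier := {ψ | ContDiff ℝ ∞ ψ ∧ HasCompactSupport ψ ∧ tsupport ψ ⊆ Ioo a b}
  zero_mem' := ⟨contDiff_const, HasCompactSupport.zero, by simp [tsupport]⟩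
  add_mem' := fun h h' => ⟨h.1.add h'.1, h.2.1.add h'.2.1,
    (tsupport_add _ _).trans (union_subset h.2.2 h'.2.2)⟩
  smul_mem' := fun c _ h => ⟨h.1.const_smul c, h.2.1.smul_left (f := fun _ => c),
    (tsupport_smul_subset_right (fun _ => c) _).trans h.2.2⟩

theorem continuous_of_mem_testFunctions (hψ : ψ ∈ testFunctions a b) : Continuous ψ :=
  hψ.1.continuous

theorem integrable_of_mem_testFunctions (hψ : ψ ∈ testFunctions a b) : Integrable ψ :=
  (continuous_of_mem_testFunctions hψ).integrable_of_hasCompactSupport hψ.2.1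

theorem eq_zero_of_mem_testFunctions (hψ : ψ ∈ testFunctions a b) {x : ℝ} (hx : x ∉ Ioo a b) :
    ψ x = 0 :=
  image_eq_zero_of_notMem_tsupport fun hx' => hx (hψ.2.2 hx')

theorem deriv_mem_testFunctions (hψ : ψ ∈ testFunctions a b) : deriv ψ ∈ testFunctions a b :=
  ⟨(contDiff_infty_iff_deriv.1 hψ.1).2, hψ.2.1.deriv, (tsupport_deriv_subset (𝕜 := ℝ)).trans hψ.2.2⟩

theorem iteratedDeriv_two_eq (ψ : ℝ → ℝ) : iteratedDeriv 2 ψ = deriv (deriv ψ) := by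
  rw [iteratedDeriv_succ, iteratedDeriv_one]

theorem iteratedDeriv_two_mem_testFunctions (hψ : ψ ∈ testFunctions a b) :
    iteratedDeriv 2 ψ ∈ testFunctions a b :=
  iteratedDeriv_two_eq ψ ▸ deriv_mem_testFunctions (deriv_mem_testFunctions hψ)

theorem setIntegral_mul_testFunction (w : ℝ → ℝ) (hψ : ψ ∈ testFunctions a b) :
    ∫ x in Ioo a b, w x * ψ x = ∫ x, w x * ψ x :=
  setIntegral_eq_integral_of_forall_compl_eq_zero fun x hx => by
    rw [eq_zero_of_mem_testFunctions hψ hx, mul_zero]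

theorem integrableOn_mul_testFunction (hw : IntegrableOn w (Ioo a b))
    (hψ : ψ ∈ testFunctions a b) : IntegrableOn (fun x => w x * ψ x) (Ioo a b) := by
  have hcont := continuous_of_mem_testFunctions hψ
  obtain ⟨c, hc⟩ := hψ.2.1.exists_bound_of_continuous hcont
  exact hw.mul_bdd (c := c) hcont.aestronglyMeasurable (Eventually.of_forall hc)

theorem exists_Icc_of_mem_testFunctions (hψ : ψ ∈ testFunctions a b) :
    ∃ c d, tsupport ψ ⊆ Icc c d ∧ Icc c d ⊆ Ioo a b := by
  have hc : IsCompact (tsupport ψ) := hψ.2.1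
  rcases (tsupport ψ).eq_empty_or_nonempty with hempty | hne
  · exact ⟨1, 0, by simp [hempty], by simp⟩
  · exact ⟨sInf (tsupport ψ), sSup (tsupport ψ),
      fun x hx => ⟨csInf_le hc.bddBelow hx, le_csSup hc.bddAbove hx⟩,
      Icc_subset_Ioo (hψ.2.2 (hc.sInf_mem hne)).1 (hψ.2.2 (hc.sSup_mem hne)).2⟩

theorem primitive_eq_zero_of_notMem {c d : ℝ} (hsupp : tsupport χ ⊆ Icc c d)
    (hcd : Icc c d ⊆ Ioo a b) (hχ : ∫ x, χ x = 0) {y : ℝ} (hy : y ∉ Icc c d) :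
    ∫ x in a..y, χ x = 0 := by
  rcases lt_or_ge y c with hyc | hcy
  · refine (intervalIntegral.integral_congr (g := fun _ => (0 : ℝ)) fun x hx => ?_).trans
      intervalIntegral.integral_zero
    refine image_eq_zero_of_notMem_tsupport fun hxs => ?_
    have hxcd := hsupp hxs
    rcases le_sup_iff.1 hx.2 with hxa | hxy
    · exact (hcd hxcd).1.not_ge hxa
    · exact (hyc.trans_le hxcd.1).not_ge hxy
  · have hdy : d < y := lt_of_not_ge fun hyd => hy ⟨hcy, hyd⟩
    rw [intervalIntegral.integral_eq_integral_of_support_subset, hχ]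
    exact fun x hx => have hxcd := hsupp (subset_tsupport χ hx)
      ⟨(hcd hxcd).1, hxcd.2.trans hdy.le⟩

theorem exists_deriv_eq_of_integral_eq_zero (hχ : χ ∈ testFunctions a b) (h0 : ∫ x, χ x = 0) :
    ∃ ψ ∈ testFunctions a b, deriv ψ = χ := by
  obtain ⟨c, d, hsupp, hcd⟩ := exists_Icc_of_mem_testFunctions hχ
  have hcont := continuous_of_mem_testFunctions hχ
  set ψ : ℝ → ℝ := fun y => ∫ x in a..y, χ x
  have hψ (y : ℝ) : HasDerivAt ψ (χ y) y :=
    intervalIntegral.integral_hasDerivAt_right (hcont.intervalIntegrable _ _)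
      hcont.aestronglyMeasurable.stronglyMeasurableAtFilter hcont.continuousAt
  have hderiv : deriv ψ = χ := funext fun y => (hψ y).deriv
  have hψsupp : Function.support ψ ⊆ Icc c d := fun y hy => by
    by_contra hyn
    exact hy (primitive_eq_zero_of_notMem hsupp hcd h0 hyn)
  refine ⟨ψ, ⟨contDiff_infty_iff_deriv.2 ⟨fun y => (hψ y).differentiableAt, hderiv ▸ hχ.1⟩,
    HasCompactSupport.of_support_subset_isCompact isCompact_Icc hψsupp,
    (closure_minimal hψsupp isClosed_Icc).trans hcd⟩, hderiv⟩

theorem exists_iteratedDeriv_two_eq (hχ : χ ∈ testFunctions a b) (h0 : ∫ x, χ x = 0)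
    (h1 : ∫ x, x * χ x = 0) : ∃ ψ ∈ testFunctions a b, iteratedDeriv 2 ψ = χ := by
  obtain ⟨ψ₁, hψ₁, rfl⟩ := exists_deriv_eq_of_integral_eq_zero hχ h0
  have hmul {χ : ℝ → ℝ} (hχ : χ ∈ testFunctions a b) : Integrable (fun x => x * χ x) :=
    (continuous_id.mul (continuous_of_mem_testFunctions hχ)).integrable_of_hasCompactSupport
      hχ.2.1.mul_left
  have hparts := integral_mul_deriv_eq_deriv_mul_of_integrable (u := fun x => x) (v := ψ₁)
    (fun x _ => hasDerivAt_id x)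
    (fun x _ => (hψ₁.1.differentiable (by simp) x).hasDerivAt) (hmul hχ)
    (by simpa only [Pi.mul_def, one_mul] using integrable_of_mem_testFunctions hψ₁) (hmul hψ₁)
  obtain ⟨ψ, hψ, rfl⟩ := exists_deriv_eq_of_integral_eq_zero hψ₁ (by simpa [h1] using hparts)
  exact ⟨ψ, hψ, iteratedDeriv_two_eq ψ⟩

/-- The linear form `ψ ↦ ∫ w ψ` on the test functions. -/
noncomputable def testPairing (hw : IntegrableOn w (Ioo a b)) : testFunctions a b →ₗ[ℝ] ℝ where
  toFun ψ := ∫ x in Ioo a b, w x * (ψ : ℝ → ℝ) x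
  map_add' ψ χ := by
    simp only [Submodule.coe_add, Pi.add_apply, mul_add]
    exact integral_add (integrableOn_mul_testFunction hw ψ.2)
      (integrableOn_mul_testFunction hw χ.2)
  map_smul' c ψ := by
    simp only [Submodule.coe_smul, Pi.smul_apply, smul_eq_mul, mul_left_comm, RingHom.id_apply]
    exact integral_const_mul c _

-- A form that annihilates all second derivatives vanishes on the common kernel of `ψ ↦ ∫ ψ` and
-- `ψ ↦ ∫ x ψ`, hence is a linear combination of these two.
theorem exists_testPairing_eq (hw : IntegrableOn w (Ioo a b))
    (h : ∀ ψ ∈ testFunctions a b, ∫ x in Ioo a b, w x * iteratedDeriv 2 ψ x = 0) :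
    ∃ c : Fin 2 → ℝ, ∀ ψ ∈ testFunctions a b,
      ∫ x in Ioo a b, w x * ψ x = ∫ x in Ioo a b, (c 0 + c 1 * x) * ψ x := by
  have hconst : IntegrableOn (fun _ => (1 : ℝ)) (Ioo a b) := by simp
  have hid : IntegrableOn (fun x : ℝ => x) (Ioo a b) :=
    continuous_id.continuousOn.integrableOn_Icc.mono_set Ioo_subset_Icc_self
  have hmem := mem_span_of_iInf_ker_le_ker (L := ![testPairing hconst, testPairing hid])
    (K := testPairing hw) (by
      rintro ⟨χ, hχ⟩ hker
      simp only [Submodule.mem_iInf, Fin.forall_fin_two, LinearMap.mem_ker, testPairing,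
        Matrix.cons_val_zero, Matrix.cons_val_one, LinearMap.coe_mk, AddHom.coe_mk,
        setIntegral_mul_testFunction _ hχ] at hker
      obtain ⟨ψ, hψ, rfl⟩ := exists_iteratedDeriv_two_eq hχ (by simpa using hker.1) hker.2
      exact h ψ hψ)
  obtain ⟨c, hc⟩ := (Submodule.mem_span_range_iff_exists_fun ℝ).1 hmem
  refine ⟨c, fun ψ hψ => ?_⟩
  have hcψ := LinearMap.congr_fun hc ⟨ψ, hψ⟩
  simp only [testPairing, Fin.sum_univ_two, Matrix.cons_val_zero, Matrix.cons_val_one,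
    LinearMap.add_apply, LinearMap.smul_apply, LinearMap.coe_mk, AddHom.coe_mk, smul_eq_mul,
    ← integral_const_mul] at hcψ
  rw [← hcψ, ← integral_add ((integrableOn_mul_testFunction hconst hψ).const_mul _)
    ((integrableOn_mul_testFunction hid hψ).const_mul _)]
  exact integral_congr_ae (Eventually.of_forall fun x => by ring)

theorem ae_eq_affine_of_integral_mul_iteratedDeriv_eq_zero (hw : IntegrableOn w (Ioo a b))
    (h : ∀ ψ ∈ testFunctions a b, ∫ x in Ioo a b, w x * iteratedDeriv 2 ψ x = 0) :
    ∃ c₀ c₁ : ℝ, w =ᵐ[volume.restrict (Ioo a b)] fun x => c₀ + c₁ * x := by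
  obtain ⟨c, hc⟩ := exists_testPairing_eq hw h
  have haff : IntegrableOn (fun x => c 0 + c 1 * x) (Ioo a b) :=
    (by fun_prop : Continuous fun x => c 0 + c 1 * x).continuousOn.integrableOn_Icc.mono_set
      Ioo_subset_Icc_self
  refine ⟨c 0, c 1, (ae_restrict_iff' measurableSet_Ioo).2 ?_⟩
  have hzero := isOpen_Ioo.ae_eq_zero_of_integral_contDiff_smul_eq_zero (μ := volume)
    (hw.sub haff).locallyIntegrableOn fun ψ h₁ h₂ h₃ => by
      have hψ : ψ ∈ testFunctions a b := ⟨h₁, h₂, h₃⟩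
      simp only [smul_eq_mul, mul_comm (ψ _)]
      rw [← setIntegral_mul_testFunction _ hψ]
      simp only [Pi.sub_apply, sub_mul]
      rw [integral_sub (integrableOn_mul_testFunction hw hψ)
        (integrableOn_mul_testFunction haff hψ), hc ψ hψ, sub_self]
  filter_upwards [hzero] with x hx hxmem
  exact sub_eq_zero.1 (hx hxmem)

end TestFunctions

/-! ### Double primitives and the Sobolev space -/

section DoublePrimitive

variable {g φ ψ : ℝ → ℝ} {a b s t x : ℝ}

/-- The truncated power `(x - s)₊`, the fundamental solution of the second derivative. -/
def ramp (s x : ℝ) : ℝ := max (x - s) 0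

/-- The double primitive of `g` on `(0,1)` that vanishes to first order at `0`. -/
noncomputable def doublePrimitive (g : ℝ → ℝ) (x : ℝ) : ℝ :=
  ∫ s in Ioo (0 : ℝ) 1, ramp s x * g s

/-- The singular integral of the truncated power `(x - s)₊`, as a function of `s`. -/
noncomputable def singularKernel (t s : ℝ) : ℝ :=
  (∫ x in Ioo (0 : ℝ) 1, slope (ramp s) t x) + ramp s t * g₀ t

theorem continuous_ramp : Continuous fun p : ℝ × ℝ => ramp p.1 p.2 := by
  unfold ramp
  fun_prop

theorem ramp_of_le (h : x ≤ s) : ramp s x = 0 := max_eq_right (sub_nonpos.2 h)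

theorem ramp_of_ge (h : s ≤ x) : ramp s x = x - s := max_eq_left (sub_nonneg.2 h)

theorem abs_ramp_le_one (hx : x ≤ 1) (hs : 0 ≤ s) : |ramp s x| ≤ 1 := by
  rw [ramp, abs_of_nonneg (le_max_right _ _)]
  exact max_le (by linarith) zero_le_one

theorem abs_slope_ramp_le_one (s t x : ℝ) : |slope (ramp s) t x| ≤ 1 := by
  rw [slope_def_field, abs_div]
  refine div_le_one_of_le₀ ((abs_max_sub_max_le_abs _ _ _).trans_eq ?_) (abs_nonneg _)
  rw [sub_sub_sub_cancel_right]

theorem measurable_slope_ramp (t : ℝ) :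
    Measurable fun p : ℝ × ℝ => slope (ramp p.1) t p.2 := by
  simp only [slope_def_field, ramp]
  fun_prop

theorem abs_singularKernel_le (ht₁ : t < 1) (hs : 0 ≤ s) :
    |singularKernel t s| ≤ 1 + |g₀ t| := by
  refine (abs_add_le _ _).trans (add_le_add ?_ ?_)
  · simpa using norm_setIntegral_le_of_norm_le_const (μ := volume) (s := Ioo (0 : ℝ) 1)
      (f := slope (ramp s) t) (by simp) fun x _ => abs_slope_ramp_le_one s t x
  · rw [abs_mul]
    exact mul_le_of_le_one_left (abs_nonneg _) (abs_ramp_le_one ht₁.le hs)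

theorem stronglyMeasurable_singularKernel (t : ℝ) : StronglyMeasurable (singularKernel t) := by
  refine StronglyMeasurable.add ?_ ?_
  · exact (measurable_slope_ramp t).stronglyMeasurable.integral_prod_right
  · exact ((continuous_ramp.comp (.prodMk_left t)).mul continuous_const).stronglyMeasurable

theorem integrableOn_ramp_mul (hg : IntegrableOn g (Ioo 0 1)) (hx : x ≤ 1) :
    IntegrableOn (fun s => ramp s x * g s) (Ioo 0 1) := by
  refine hg.bdd_mul (c := 1)
    (continuous_ramp.comp (.prodMk_left x)).aestronglyMeasurable ?_
  filter_upwards [ae_restrict_mem measurableSet_Ioo] with s hs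
  exact abs_ramp_le_one hx hs.1.le

theorem slope_affine_add_doublePrimitive (hg : IntegrableOn g (Ioo 0 1)) (ht : t ≤ 1)
    (hx : x ≤ 1) (hxt : x ≠ t) :
    slope (fun x => a + b * x + doublePrimitive g x) t x =
      b + ∫ s in Ioo (0 : ℝ) 1, slope (ramp s) t x * g s := by
  have hxt' : x - t ≠ 0 := sub_ne_zero.2 hxt
  have hslope : ∫ s in Ioo (0 : ℝ) 1, slope (ramp s) t x * g s =
      (doublePrimitive g x - doublePrimitive g t) / (x - t) := by
    rw [doublePrimitive, doublePrimitive,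
      ← integral_sub (integrableOn_ramp_mul hg hx) (integrableOn_ramp_mul hg ht), ← integral_div]
    refine integral_congr_ae (Eventually.of_forall fun s => ?_)
    simp only [slope_def_field]
    ring
  rw [hslope, slope_def_field]
  field_simp
  ring

theorem integrable_slope_ramp_mul (hg : IntegrableOn g (Ioo 0 1)) (t : ℝ) :
    Integrable (fun p : ℝ × ℝ => slope (ramp p.2) t p.1 * g p.2)
      ((volume.restrict (Ioo 0 1)).prod (volume.restrict (Ioo 0 1))) :=
  Integrable.bdd_mul (c := 1) (Integrable.comp_snd hg _)
    ((measurable_slope_ramp t).comp measurable_swap).aestronglyMeasurable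
    (Eventually.of_forall fun p => abs_slope_ramp_le_one p.2 t p.1)

theorem hasSingularIntegral_affine_add_doublePrimitive (ht₀ : 0 < t) (ht₁ : t < 1)
    (hg : IntegrableOn g (Ioo 0 1)) (a b : ℝ) :
    HasSingularIntegral (fun x => a + b * x + doublePrimitive g x) t
      (a * g₀ t + b * g₁ t + ∫ s in Ioo (0 : ℝ) 1, singularKernel t s * g s) := by
  have hint := integrable_slope_ramp_mul hg t
  have hslope : (fun x => b + ∫ s in Ioo (0 : ℝ) 1, slope (ramp s) t x * g s)
      =ᵐ[volume.restrict (Ioo 0 1)] slope (fun x => a + b * x + doublePrimitive g x) t := by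
    filter_upwards [ae_restrict_mem measurableSet_Ioo,
      ae_restrict_of_ae (Measure.ae_ne volume t)] with x hx hxt
    exact (slope_affine_add_doublePrimitive hg ht₁.le hx.2.le hxt).symm
  have hkernel (s : ℝ) : singularKernel t s * g s =
      (∫ x in Ioo (0 : ℝ) 1, slope (ramp s) t x * g s) + g₀ t * (ramp s t * g s) := by
    rw [integral_mul_const, singularKernel]
    ring
  have hleft : Integrable (fun x => ∫ s in Ioo (0 : ℝ) 1, slope (ramp s) t x * g s)
      (volume.restrict (Ioo 0 1)) := hint.integral_prod_left
  have hright : Integrable (fun s => ∫ x in Ioo (0 : ℝ) 1, slope (ramp s) t x * g s)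
      (volume.restrict (Ioo 0 1)) := hint.integral_prod_right
  convert hasSingularIntegral_of_slope ht₀ ht₁
    ((intervalIntegrable_iff_integrableOn_Ioo_of_le zero_le_one).2
      (((integrable_const b).add hleft).congr hslope)) using 1
  rw [intervalIntegral.integral_of_le zero_le_one, integral_Ioc_eq_integral_Ioo,
    ← integral_congr_ae hslope, integral_add (integrable_const b) hleft,
    integral_integral_swap hint, funext hkernel,
    integral_add hright ((integrableOn_ramp_mul hg ht₁.le).const_mul _), integral_const_mul,
    ← doublePrimitive, g₁, ← g₀]
  simp only [integral_const, measureReal_restrict_apply_univ, Real.volume_real_Ioo_of_le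
    zero_le_one, sub_zero, one_smul]
  ring

theorem hasSingularIntegral_id (ht₀ : 0 < t) (ht₁ : t < 1) :
    HasSingularIntegral (fun x => x) t (g₁ t) := by
  simpa [doublePrimitive] using hasSingularIntegral_affine_add_doublePrimitive (g := fun _ => 0)
    ht₀ ht₁ (by simp) 0 1

theorem continuousOn_doublePrimitive (hg : IntegrableOn g (Ioo 0 1)) :
    ContinuousOn (doublePrimitive g) (Icc 0 1) := by
  refine continuousOn_of_dominated (bound := fun s => |g s|)
    (fun x hx => (integrableOn_ramp_mul hg hx.2).aestronglyMeasurable) (fun x hx => ?_) hg.abs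
    (Eventually.of_forall fun s => ?_)
  · filter_upwards [ae_restrict_mem measurableSet_Ioo] with s hs
    rw [Real.norm_eq_abs, abs_mul]
    exact mul_le_of_le_one_left (abs_nonneg _) (abs_ramp_le_one hx.2 hs.1.le)
  · exact ((continuous_ramp.comp (.prodMk_right s)).mul continuous_const).continuousOn

theorem integral_ramp_mul_iteratedDeriv_two (hψ : ContDiff ℝ 2 ψ) (hψs : HasCompactSupport ψ)
    (s : ℝ) : ∫ x, ramp s x * iteratedDeriv 2 ψ x = ψ s := by
  have hψ₁ : ContDiff ℝ 1 (deriv ψ) := (contDiff_succ_iff_deriv (n := 1).1 hψ).2.2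
  have hderiv : deriv (fun x => (x - s) * deriv ψ x - ψ x) =
      fun x => (x - s) * iteratedDeriv 2 ψ x := by
    ext x
    have hψx := (hψ.differentiable (by simp) x).hasDerivAt
    have hψ₁x := (hψ₁.differentiable (by simp) x).hasDerivAt
    refine (((((hasDerivAt_id x).sub_const s).mul hψ₁x).sub hψx).congr_deriv ?_).deriv
    simp [iteratedDeriv_two_eq]
  have hIoi := HasCompactSupport.integral_Ioi_deriv_eq (f := fun x => (x - s) * deriv ψ x - ψ x)
    (((contDiff_id.sub contDiff_const).mul hψ₁).sub (hψ.of_le (by norm_num)))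
    (hψs.deriv.mul_left.sub hψs) s
  rw [hderiv, sub_self, zero_mul, zero_sub, neg_neg] at hIoi
  rw [← hIoi, ← setIntegral_eq_integral_of_forall_compl_eq_zero (s := Ioi s) fun x hx => by
    rw [ramp_of_le (not_lt.1 hx), zero_mul]]
  exact setIntegral_congr_fun measurableSet_Ioi fun x hx => by rw [ramp_of_ge (le_of_lt hx)]

theorem isWeakSecondDeriv_doublePrimitive (hg : IntegrableOn g (Ioo 0 1)) :
    IsWeakSecondDeriv (doublePrimitive g) g := by
  intro ψ hψ hψs hψsub
  have hψ₂ := iteratedDeriv_two_mem_testFunctions (a := 0) (b := 1) ⟨hψ, hψs, hψsub⟩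
  have hint : Integrable (fun p : ℝ × ℝ => ramp p.2 p.1 * (iteratedDeriv 2 ψ p.1 * g p.2))
      ((volume.restrict (Ioo 0 1)).prod (volume.restrict (Ioo 0 1))) := by
    refine ((integrable_of_mem_testFunctions hψ₂).integrableOn.mul_prod hg).bdd_mul (c := 1)
      (continuous_ramp.comp continuous_swap).aestronglyMeasurable ?_
    rw [Measure.prod_restrict]
    filter_upwards [ae_restrict_mem (measurableSet_Ioo.prod measurableSet_Ioo)] with p hp
    exact abs_ramp_le_one hp.1.2.le hp.2.1.le
  calc ∫ x in Ioo (0 : ℝ) 1, doublePrimitive g x * iteratedDeriv 2 ψ x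
      = ∫ x in Ioo (0 : ℝ) 1, ∫ s in Ioo (0 : ℝ) 1,
          ramp s x * (iteratedDeriv 2 ψ x * g s) := by
        simp only [doublePrimitive, ← integral_mul_const, mul_assoc, mul_comm (g _)]
    _ = ∫ s in Ioo (0 : ℝ) 1, ∫ x in Ioo (0 : ℝ) 1,
          ramp s x * (iteratedDeriv 2 ψ x * g s) := integral_integral_swap hint
    _ = ∫ s in Ioo (0 : ℝ) 1, g s * ψ s := by
        congr with s
        simp only [← mul_assoc]
        rw [integral_mul_const, setIntegral_mul_testFunction _ hψ₂,
          integral_ramp_mul_iteratedDeriv_two (contDiff_infty.1 hψ 2) hψs, mul_comm]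

theorem memSobolevWith_doublePrimitive (hg : MemLp g 2 (volume.restrict (Ioo 0 1))) :
    MemSobolevWith (doublePrimitive g) g :=
  have hg₁ : IntegrableOn g (Ioo 0 1) := hg.integrable one_le_two
  ⟨continuousOn_doublePrimitive hg₁, hg, isWeakSecondDeriv_doublePrimitive hg₁⟩

theorem MemSobolevWith.exists_eqOn (h : MemSobolevWith φ g) :
    ∃ a b : ℝ, EqOn φ (fun x => a + b * x + doublePrimitive g x) (Icc 0 1) := by
  have hd := memSobolevWith_doublePrimitive h.memLp
  have hint {w : ℝ → ℝ} (hw : ContinuousOn w (Icc 0 1)) : IntegrableOn w (Ioo 0 1) :=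
    hw.integrableOn_Icc.mono_set Ioo_subset_Icc_self
  have hcont := h.continuousOn.sub hd.continuousOn
  obtain ⟨a, b, hab⟩ := ae_eq_affine_of_integral_mul_iteratedDeriv_eq_zero (hint hcont)
    fun ψ hψ => by
      have hψ₂ := iteratedDeriv_two_mem_testFunctions hψ
      simp only [Pi.sub_apply, sub_mul]
      rw [integral_sub (integrableOn_mul_testFunction (hint h.continuousOn) hψ₂)
        (integrableOn_mul_testFunction (hint hd.continuousOn) hψ₂),
        h.weakDeriv ψ hψ.1 hψ.2.1 hψ.2.2, hd.weakDeriv ψ hψ.1 hψ.2.1 hψ.2.2, sub_self]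
  rw [Measure.restrict_congr_set Ioo_ae_eq_Icc] at hab
  have heq := Measure.eqOn_Icc_of_ae_eq volume (zero_ne_one' ℝ) hab hcont (by fun_prop)
  exact ⟨a, b, fun x hx => sub_eq_iff_eq_add.1 (heq hx)⟩

theorem MemSobolevWith.hasSingularIntegral (h : MemSobolevWith φ g) (ht₀ : 0 < t) (ht₁ : t < 1) :
    HasSingularIntegral φ t (singularIntegral φ t) := by
  obtain ⟨a, b, hab⟩ := h.exists_eqOn
  have hφ := (hasSingularIntegral_affine_add_doublePrimitive ht₀ ht₁
    (h.memLp.integrable one_le_two) a b).congr ht₀ ht₁ hab.symm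
  rwa [hφ.singularIntegral_eq]

end DoublePrimitive

/-! ### Classical elements of the Sobolev space -/

section Classical

variable {v v' φ φ₁ φ₂ ψ : ℝ → ℝ} {a b : ℝ}

theorem integral_mul_deriv_testFunction (hv : ∀ x, HasDerivAt v (v' x) x) (hv' : Continuous v')
    (hψ : ψ ∈ testFunctions a b) : ∫ x, v x * deriv ψ x = -∫ x, v' x * ψ x := by
  have hint {w ψ : ℝ → ℝ} (hw : Continuous w) (hψ : ψ ∈ testFunctions a b) :
      Integrable (w * ψ) :=
    (hw.mul (continuous_of_mem_testFunctions hψ)).integrable_of_hasCompactSupport hψ.2.1.mul_left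
  have hv_cont : Continuous v := continuous_iff_continuousAt.2 fun x => (hv x).continuousAt
  exact integral_mul_deriv_eq_deriv_mul_of_integrable (fun x _ => hv x)
    (fun x _ => (hψ.1.differentiable (by simp) x).hasDerivAt)
    (hint hv_cont (deriv_mem_testFunctions hψ)) (hint hv' hψ) (hint hv_cont hψ)

theorem memLp_two_of_continuous {w : ℝ → ℝ} (hw : Continuous w) :
    MemLp w 2 (volume.restrict (Ioo a b)) := by
  obtain ⟨M, hM⟩ := isCompact_Icc.exists_bound_of_continuousOn hw.continuousOn
  refine MemLp.of_bound hw.aestronglyMeasurable M ?_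
  filter_upwards [ae_restrict_mem measurableSet_Ioo] with x hx
  exact hM x (Ioo_subset_Icc_self hx)

theorem memSobolevWith_of_hasDerivAt (h₁ : ∀ x, HasDerivAt φ (φ₁ x) x)
    (h₂ : ∀ x, HasDerivAt φ₁ (φ₂ x) x) (hφ₂ : Continuous φ₂) : MemSobolevWith φ φ₂ := by
  have hφ : Continuous φ := continuous_iff_continuousAt.2 fun x => (h₁ x).continuousAt
  have hφ₁ : Continuous φ₁ := continuous_iff_continuousAt.2 fun x => (h₂ x).continuousAt
  refine ⟨hφ.continuousOn, memLp_two_of_continuous hφ₂, fun ψ hψ hψs hψsub => ?_⟩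
  have hmem : ψ ∈ testFunctions 0 1 := ⟨hψ, hψs, hψsub⟩
  rw [setIntegral_mul_testFunction _ (iteratedDeriv_two_mem_testFunctions hmem),
    iteratedDeriv_two_eq, integral_mul_deriv_testFunction h₁ hφ₁ (deriv_mem_testFunctions hmem),
    integral_mul_deriv_testFunction h₂ hφ₂ hmem, neg_neg, setIntegral_mul_testFunction _ hmem]

theorem memSobolevWith_affine (a b : ℝ) : MemSobolevWith (fun x => a + b * x) fun _ => 0 :=
  memSobolevWith_of_hasDerivAt (φ₁ := fun _ => b)
    (fun x => by simpa using ((hasDerivAt_id x).const_mul b).const_add a)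
    (fun x => hasDerivAt_const x b) continuous_const

theorem hasDerivAt_mul_abs (x : ℝ) : HasDerivAt (fun x : ℝ => x * |x|) (2 * |x|) x := by
  rcases eq_or_ne x 0 with rfl | hx
  · have hslope : slope (fun x : ℝ => x * |x|) 0 =ᶠ[𝓝[≠] 0] fun x => |x| := by
      filter_upwards [self_mem_nhdsWithin] with x hx
      rw [slope_def_field, abs_zero, mul_zero, sub_zero, sub_zero, mul_div_cancel_left₀ _ hx]
    rw [hasDerivAt_iff_tendsto_slope, tendsto_congr' hslope, abs_zero, mul_zero]
    exact (continuous_abs.tendsto' 0 0 abs_zero).mono_left nhdsWithin_le_nhds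
  · refine ((hasDerivAt_id x).mul (hasDerivAt_abs hx)).congr_deriv ?_
    rw [id, one_mul, self_mul_sign, two_mul]

theorem hasDerivAt_abs_cubed (x : ℝ) : HasDerivAt (fun x : ℝ => |x| ^ 3) (3 * (x * |x|)) x := by
  have heq : (fun x : ℝ => |x| ^ 3) = fun x => x * (x * |x|) := by
    ext x
    rw [pow_succ, sq_abs]
    ring
  rw [heq]
  refine ((hasDerivAt_id x).mul (hasDerivAt_mul_abs x)).congr_deriv ?_
  simp only [id]
  ring

theorem memSobolevWith_abs_cubed (y : ℝ) :
    MemSobolevWith (fun x => |x - y| ^ 3) fun x => 6 * |x - y| := by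
  refine memSobolevWith_of_hasDerivAt (fun x => (hasDerivAt_abs_cubed (x - y)).comp_sub_const x y)
    (fun x => ?_) (by fun_prop)
  refine (((hasDerivAt_mul_abs (x - y)).comp_sub_const x y).const_mul 3).congr_deriv ?_
  ring

end Classical

/-! ### Duality in `L²` -/

section Duality

variable {α : Type*} [MeasurableSpace α] {μ : Measure α} {K g : α → ℝ}

theorem eLpNorm_two_eq_ofReal_sqrt (hg : MemLp g 2 μ) :
    eLpNorm g 2 μ = ENNReal.ofReal √(∫ x, g x ^ 2 ∂μ) := by
  rw [hg.eLpNorm_eq_integral_rpow_norm (by norm_num) (by norm_num), Real.sqrt_eq_rpow]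
  simp

theorem ofReal_abs_integral_mul_le (hK : AEStronglyMeasurable K μ) (hg : AEStronglyMeasurable g μ)
    (hg₁ : eLpNorm g 2 μ ≤ 1) : ENNReal.ofReal |∫ x, K x * g x ∂μ| ≤ eLpNorm K 2 μ :=
  calc ENNReal.ofReal |∫ x, K x * g x ∂μ|
      = ‖∫ x, K x * g x ∂μ‖ₑ := (Real.enorm_eq_ofReal_abs _).symm
    _ ≤ ∫⁻ x, ‖(K • g) x‖ₑ ∂μ := enorm_integral_le_lintegral_enorm _
    _ = eLpNorm (K • g) 1 μ := eLpNorm_one_eq_lintegral_enorm.symm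
    _ ≤ eLpNorm K 2 μ * eLpNorm g 2 μ := eLpNorm_smul_le_mul_eLpNorm hg hK
    _ ≤ eLpNorm K 2 μ := mul_le_of_le_one_right' hg₁

theorem exists_ofReal_abs_integral_mul_eq (hK : MemLp K 2 μ) :
    ∃ g, MemLp g 2 μ ∧ eLpNorm g 2 μ ≤ 1 ∧
      ENNReal.ofReal |∫ x, K x * g x ∂μ| = eLpNorm K 2 μ := by
  set c := √(∫ x, K x ^ 2 ∂μ) with hc
  have hc_sq : ∫ x, K x ^ 2 ∂μ = c ^ 2 :=
    (Real.sq_sqrt (integral_nonneg fun x => sq_nonneg (K x))).symm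
  have hc₀ : 0 ≤ c := Real.sqrt_nonneg _
  refine ⟨fun x => c⁻¹ * K x, hK.const_mul _, ?_, ?_⟩
  · rw [eLpNorm_two_eq_ofReal_sqrt (hK.const_mul _), ENNReal.ofReal_le_one]
    simp only [mul_pow]
    rw [integral_const_mul, hc_sq, ← mul_pow, Real.sqrt_sq (by positivity)]
    exact inv_mul_le_one
  · simp only [mul_left_comm (K _), ← sq]
    rw [eLpNorm_two_eq_ofReal_sqrt hK, ← hc, integral_const_mul, hc_sq, sq, ← mul_assoc,
      inv_mul_mul_self, abs_of_nonneg hc₀]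

end Duality

/-! ### The Peano kernel of the error functional -/

section PeanoKernel

variable {N : ℕ} {t a b : ℝ} {C : Fin (N + 1) → ℝ} {φ g : ℝ → ℝ}

theorem step_pos (hN : N ≠ 0) : 0 < step N :=
  one_div_pos.2 (Nat.cast_pos.2 (Nat.pos_of_ne_zero hN))

theorem step_mul_cast (hN : N ≠ 0) : step N * N = 1 :=
  one_div_mul_cancel (Nat.cast_ne_zero.2 hN)

theorem step_mul_mem_Icc (hN : N ≠ 0) (β : Fin (N + 1)) :
    step N * (β : ℕ) ∈ Icc (0 : ℝ) 1 := by
  refine ⟨mul_nonneg (step_pos hN).le (Nat.cast_nonneg _), ?_⟩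
  rw [← step_mul_cast hN]
  exact mul_le_mul_of_nonneg_left (Nat.cast_le.2 β.is_le) (step_pos hN).le

/-- The combination `∑ β, d β * (hβ - s)₊` of truncated powers at the nodes, by which the Peano
kernels of two quadrature formulas differ. -/
noncomputable def rampSum (N : ℕ) (d : Fin (N + 1) → ℝ) (s : ℝ) : ℝ :=
  ∑ β : Fin (N + 1), d β * ramp s (step N * (β : ℕ))

/-- The Peano kernel of the error functional: it represents the error on functions that vanish to
first order at `0` as an integral against their second derivative. -/
noncomputable def errorKernel (N : ℕ) (t : ℝ) (C : Fin (N + 1) → ℝ) (s : ℝ) : ℝ :=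
  singularKernel t s - rampSum N C s

/-- The quadrature formula with coefficients `C` is exact for `1` and `x`. -/
structure IsExactOnAffine (N : ℕ) (t : ℝ) (C : Fin (N + 1) → ℝ) : Prop where
  sum_eq : ∑ γ, C γ = g₀ t
  sum_mul_eq : ∑ γ, C γ * (step N * (γ : ℕ)) = g₁ t

theorem continuous_rampSum (d : Fin (N + 1) → ℝ) : Continuous (rampSum N d) :=
  continuous_finsetSum _ fun _ _ =>
    continuous_const.mul (continuous_ramp.comp (.prodMk_left _))

theorem memLp_singularKernel (ht₁ : t < 1) :
    MemLp (singularKernel t) 2 (volume.restrict (Ioo 0 1)) := by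
  refine MemLp.of_bound (stronglyMeasurable_singularKernel t).aestronglyMeasurable (1 + |g₀ t|) ?_
  filter_upwards [ae_restrict_mem measurableSet_Ioo] with s hs
  exact abs_singularKernel_le ht₁ hs.1.le

theorem memLp_errorKernel (ht₁ : t < 1) (C : Fin (N + 1) → ℝ) :
    MemLp (errorKernel N t C) 2 (volume.restrict (Ioo 0 1)) :=
  (memLp_singularKernel ht₁).sub (memLp_two_of_continuous (continuous_rampSum C))

theorem integral_rampSum_mul (hN : N ≠ 0) (hg : IntegrableOn g (Ioo 0 1))
    (d : Fin (N + 1) → ℝ) : ∫ s in Ioo (0 : ℝ) 1, rampSum N d s * g s =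
      ∑ β : Fin (N + 1), d β * doublePrimitive g (step N * (β : ℕ)) := by
  simp only [rampSum, Finset.sum_mul, mul_assoc]
  rw [integral_finsetSum _ fun β _ =>
    (integrableOn_ramp_mul hg (step_mul_mem_Icc hN β).2).const_mul (d β)]
  simp only [integral_const_mul, doublePrimitive]

theorem integral_errorKernel_mul (hN : N ≠ 0) (ht₁ : t < 1)
    (hg : MemLp g 2 (volume.restrict (Ioo 0 1))) (C : Fin (N + 1) → ℝ) :
    ∫ s in Ioo (0 : ℝ) 1, errorKernel N t C s * g s =
      (∫ s in Ioo (0 : ℝ) 1, singularKernel t s * g s) -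
        ∑ β : Fin (N + 1), C β * doublePrimitive g (step N * (β : ℕ)) := by
  simp only [errorKernel, sub_mul]
  rw [← integral_rampSum_mul hN (hg.integrable one_le_two)]
  exact integral_sub ((memLp_singularKernel ht₁).integrable_mul hg)
    ((memLp_two_of_continuous (continuous_rampSum C)).integrable_mul hg)

theorem quadError_eq (hN : N ≠ 0) (ht₀ : 0 < t) (ht₁ : t < 1)
    (hg : MemLp g 2 (volume.restrict (Ioo 0 1)))
    (h : EqOn φ (fun x => a + b * x + doublePrimitive g x) (Icc 0 1)) :
    quadError N t C φ = a * (g₀ t - ∑ γ, C γ) + b * (g₁ t - ∑ γ, C γ * (step N * (γ : ℕ))) +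
      ∫ s in Ioo (0 : ℝ) 1, errorKernel N t C s * g s := by
  have hsum : ∑ β : Fin (N + 1), C β * φ (step N * (β : ℕ)) =
      a * ∑ γ, C γ + b * ∑ γ, C γ * (step N * (γ : ℕ)) +
        ∑ β : Fin (N + 1), C β * doublePrimitive g (step N * (β : ℕ)) := by
    rw [Finset.mul_sum, Finset.mul_sum, ← Finset.sum_add_distrib, ← Finset.sum_add_distrib]
    refine Finset.sum_congr rfl fun β _ => ?_
    rw [h (step_mul_mem_Icc hN β)]
    ring
  rw [quadError, hsum, integral_errorKernel_mul hN ht₁ hg,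
    ((hasSingularIntegral_affine_add_doublePrimitive ht₀ ht₁ (hg.integrable one_le_two) a b).congr
      ht₀ ht₁ h.symm).singularIntegral_eq]
  ring

theorem IsExactOnAffine.quadError_eq_integral (hC : IsExactOnAffine N t C) (hN : N ≠ 0)
    (ht₀ : 0 < t) (ht₁ : t < 1) (h : MemSobolevWith φ g) :
    quadError N t C φ = ∫ s in Ioo (0 : ℝ) 1, errorKernel N t C s * g s := by
  obtain ⟨a, b, hab⟩ := h.exists_eqOn
  rw [quadError_eq hN ht₀ ht₁ h.memLp hab, hC.sum_eq, hC.sum_mul_eq, sub_self, sub_self, mul_zero,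
    mul_zero, zero_add, zero_add]

theorem ofReal_abs_quadError_le_errorNorm (h : MemSobolevWith φ g)
    (hg : eLpNorm g 2 (volume.restrict (Ioo 0 1)) ≤ 1) :
    ENNReal.ofReal |quadError N t C φ| ≤ errorNorm N t C :=
  le_iSup₂_of_le φ g (le_iSup₂_of_le h hg le_rfl)

theorem IsExactOnAffine.errorNorm_eq (hC : IsExactOnAffine N t C) (hN : N ≠ 0) (ht₀ : 0 < t)
    (ht₁ : t < 1) :
    errorNorm N t C = eLpNorm (errorKernel N t C) 2 (volume.restrict (Ioo 0 1)) := by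
  have hK := memLp_errorKernel ht₁ C
  apply le_antisymm
  · refine iSup₂_le fun φ g => iSup₂_le fun h hg => ?_
    rw [hC.quadError_eq_integral hN ht₀ ht₁ h]
    exact ofReal_abs_integral_mul_le hK.1 h.memLp.1 hg
  · obtain ⟨g, hg, hg₁, heq⟩ := exists_ofReal_abs_integral_mul_eq hK
    have hφ := memSobolevWith_doublePrimitive hg
    rw [← heq, ← hC.quadError_eq_integral hN ht₀ ht₁ hφ]
    exact ofReal_abs_quadError_le_errorNorm hφ hg₁

theorem eq_zero_of_forall_abs_mul_le {x M : ℝ} (h : ∀ a : ℝ, |a * x| ≤ M) : x = 0 := by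
  by_contra hx
  have hM := h ((M + 1) / x)
  rw [div_mul_cancel₀ _ hx] at hM
  linarith [le_abs_self (M + 1)]

theorem isExactOnAffine_of_errorNorm_lt_top (hN : N ≠ 0) (ht₀ : 0 < t) (ht₁ : t < 1)
    (h : errorNorm N t C < ⊤) : IsExactOnAffine N t C := by
  have hbound (a b : ℝ) :
      |a * (g₀ t - ∑ γ, C γ) + b * (g₁ t - ∑ γ, C γ * (step N * (γ : ℕ)))| ≤
        (errorNorm N t C).toReal := by
    have hle := ofReal_abs_quadError_le_errorNorm (N := N) (t := t) (C := C)
      (memSobolevWith_affine a b) (by simp)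
    rw [quadError_eq hN ht₀ ht₁ (memSobolevWith_affine a b).memLp (a := a) (b := b)
      (fun x _ => by simp [doublePrimitive])] at hle
    simpa using (ENNReal.ofReal_le_iff_le_toReal h.ne).1 hle
  exact ⟨(sub_eq_zero.1 (eq_zero_of_forall_abs_mul_le fun a => by simpa using hbound a 0)).symm,
    (sub_eq_zero.1 (eq_zero_of_forall_abs_mul_le fun b => by simpa using hbound 0 b)).symm⟩

theorem IsExactOnAffine.errorNorm_lt_top (hC : IsExactOnAffine N t C) (hN : N ≠ 0) (ht₀ : 0 < t)
    (ht₁ : t < 1) : errorNorm N t C < ⊤ := by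
  rw [hC.errorNorm_eq hN ht₀ ht₁]
  exact (memLp_errorKernel ht₁ C).2

end PeanoKernel

/-! ### Optimality of the solution of the linear system -/

section Optimality

variable {N : ℕ} {t p₁ p₀ p₁' p₀' : ℝ} {C C' d : Fin (N + 1) → ℝ}

theorem ramp_eq_abs (s x : ℝ) : ramp s x = (|s - x| + x - s) / 2 := by
  rcases le_total s x with h | h
  · rw [ramp_of_ge h, abs_of_nonpos (sub_nonpos.2 h)]
    ring
  · rw [ramp_of_le h, abs_of_nonneg (sub_nonneg.2 h)]
    ring

theorem rampSum_eq_sum_abs (h₀ : ∑ γ, d γ = 0) (h₁ : ∑ γ, d γ * (step N * (γ : ℕ)) = 0) (s : ℝ) :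
    rampSum N d s = ∑ β : Fin (N + 1), d β / 2 * |s - step N * (β : ℕ)| :=
  calc rampSum N d s
      = ∑ β : Fin (N + 1), (d β / 2 * |s - step N * (β : ℕ)| +
          (d β * (step N * (β : ℕ)) / 2 - d β * s / 2)) :=
        Finset.sum_congr rfl fun β _ => by rw [ramp_eq_abs]; ring
    _ = ∑ β : Fin (N + 1), d β / 2 * |s - step N * (β : ℕ)| := by
        rw [Finset.sum_add_distrib, Finset.sum_sub_distrib, ← Finset.sum_div, ← Finset.sum_div,
          ← Finset.sum_mul, h₀, h₁, zero_mul, sub_self, add_zero]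

theorem SolvesSystem.isExactOnAffine (hC : SolvesSystem N t C p₁ p₀) : IsExactOnAffine N t C :=
  ⟨hC.eq_g₀, hC.eq_g₁⟩

theorem SolvesSystem.quadError_abs_cubed (hC : SolvesSystem N t C p₁ p₀) (hN : N ≠ 0)
    (ht₀ : 0 < t) (ht₁ : t < 1) (β : Fin (N + 1)) :
    quadError N t C (fun x => |x - step N * (β : ℕ)| ^ 3) =
      12 * (p₁ * (step N * (β : ℕ)) + p₀) := by
  rw [quadError,
    (hasSingularIntegral_abs_cubed (step_mul_mem_Icc hN β) ht₀ ht₁).singularIntegral_eq,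
    ← hC.eq_f β, u]
  have hsum : ∑ γ : Fin (N + 1), C γ * |step N * (γ : ℕ) - step N * (β : ℕ)| ^ 3 =
      12 * ∑ γ : Fin (N + 1), C γ * (|step N * (β : ℕ) - step N * (γ : ℕ)| ^ 3 / 12) := by
    rw [Finset.mul_sum]
    refine Finset.sum_congr rfl fun γ _ => ?_
    rw [abs_sub_comm]
    ring
  rw [hsum]
  ring

theorem SolvesSystem.integral_errorKernel_mul_abs (hC : SolvesSystem N t C p₁ p₀) (hN : N ≠ 0)
    (ht₀ : 0 < t) (ht₁ : t < 1) (β : Fin (N + 1)) :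
    ∫ s in Ioo (0 : ℝ) 1, errorKernel N t C s * |s - step N * (β : ℕ)| =
      2 * (p₁ * (step N * (β : ℕ)) + p₀) := by
  have heq := hC.isExactOnAffine.quadError_eq_integral hN ht₀ ht₁
    (memSobolevWith_abs_cubed (step N * (β : ℕ)))
  simp only [hC.quadError_abs_cubed hN ht₀ ht₁, mul_left_comm _ (6 : ℝ), integral_const_mul] at heq
  linarith

theorem SolvesSystem.integral_errorKernel_mul_rampSum (hC : SolvesSystem N t C p₁ p₀) (hN : N ≠ 0)
    (ht₀ : 0 < t) (ht₁ : t < 1) (h₀ : ∑ γ, d γ = 0)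
    (h₁ : ∑ γ, d γ * (step N * (γ : ℕ)) = 0) :
    ∫ s in Ioo (0 : ℝ) 1, errorKernel N t C s * rampSum N d s = 0 := by
  have hint (β : Fin (N + 1)) : IntegrableOn
      (fun s => d β / 2 * (errorKernel N t C s * |s - step N * (β : ℕ)|)) (Ioo 0 1) :=
    ((memLp_errorKernel ht₁ C).integrable_mul (memLp_two_of_continuous (by fun_prop))).const_mul _
  simp only [rampSum_eq_sum_abs h₀ h₁, Finset.mul_sum, mul_left_comm (errorKernel N t C _)]
  rw [integral_finsetSum _ fun β _ => hint β]
  calc ∑ β : Fin (N + 1), ∫ s in Ioo (0 : ℝ) 1,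
          d β / 2 * (errorKernel N t C s * |s - step N * (β : ℕ)|)
      = ∑ β : Fin (N + 1), (p₁ * (d β * (step N * (β : ℕ))) + p₀ * d β) :=
        Finset.sum_congr rfl fun β _ => by
          rw [integral_const_mul, hC.integral_errorKernel_mul_abs hN ht₀ ht₁]
          ring
    _ = 0 := by
        rw [Finset.sum_add_distrib, ← Finset.mul_sum, ← Finset.mul_sum, h₀, h₁, mul_zero, mul_zero,
          add_zero]

theorem errorKernel_eq_sub_rampSum (C C' : Fin (N + 1) → ℝ) (s : ℝ) :
    errorKernel N t C' s = errorKernel N t C s - rampSum N (C' - C) s := by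
  simp only [errorKernel, rampSum, Pi.sub_apply, sub_mul, Finset.sum_sub_distrib]
  ring

theorem SolvesSystem.integral_errorKernel_sq (hC : SolvesSystem N t C p₁ p₀) (hN : N ≠ 0)
    (ht₀ : 0 < t) (ht₁ : t < 1) (hC' : IsExactOnAffine N t C') :
    ∫ s in Ioo (0 : ℝ) 1, errorKernel N t C' s ^ 2 =
      (∫ s in Ioo (0 : ℝ) 1, errorKernel N t C s ^ 2) +
        ∫ s in Ioo (0 : ℝ) 1, rampSum N (C' - C) s ^ 2 := by
  have horth := hC.integral_errorKernel_mul_rampSum hN ht₀ ht₁ (d := C' - C)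
    (by simp [Finset.sum_sub_distrib, hC'.sum_eq, hC.eq_g₀])
    (by simp [sub_mul, Finset.sum_sub_distrib, hC'.sum_mul_eq, hC.eq_g₁])
  have hK := memLp_errorKernel ht₁ C
  have hR : MemLp (rampSum N (C' - C)) 2 (volume.restrict (Ioo 0 1)) :=
    memLp_two_of_continuous (continuous_rampSum _)
  have hKR : IntegrableOn (fun s => 2 * (errorKernel N t C s * rampSum N (C' - C) s)) (Ioo 0 1) :=
    (hK.integrable_mul hR).const_mul 2
  have hsub : IntegrableOn (fun s => errorKernel N t C s ^ 2 -
      2 * (errorKernel N t C s * rampSum N (C' - C) s)) (Ioo 0 1) := hK.integrable_sq.sub hKR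
  simp only [errorKernel_eq_sub_rampSum C C', sub_sq, mul_assoc]
  rw [integral_add hsub hR.integrable_sq,
    integral_sub hK.integrable_sq hKR, integral_const_mul, horth, mul_zero, sub_zero]

theorem ramp_second_difference {h : ℝ} (hh : 0 ≤ h) (j k : ℕ) :
    ramp (h * (k - 1)) (h * j) - 2 * ramp (h * k) (h * j) + ramp (h * (k + 1)) (h * j) =
      if j = k then h else 0 := by
  rcases lt_trichotomy j k with hjk | rfl | hkj
  · have hle : (j : ℝ) + 1 ≤ k := by exact_mod_cast hjk
    rw [ramp_of_le (by gcongr; linarith), ramp_of_le (by gcongr),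
      ramp_of_le (by gcongr; linarith), if_neg hjk.ne]
    ring
  · rw [ramp_of_ge (by gcongr; linarith), ramp_of_le le_rfl, ramp_of_le (by gcongr; linarith),
      if_pos rfl]
    ring
  · have hle : (k : ℝ) + 1 ≤ j := by exact_mod_cast hkj
    rw [ramp_of_ge (by gcongr; linarith), ramp_of_ge (by gcongr),
      ramp_of_ge (by gcongr), if_neg hkj.ne']
    ring

theorem rampSum_second_difference (hN : N ≠ 0) (d : Fin (N + 1) → ℝ) (k : Fin (N + 1)) :
    rampSum N d (step N * ((k : ℕ) - 1)) - 2 * rampSum N d (step N * (k : ℕ)) +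
      rampSum N d (step N * ((k : ℕ) + 1)) = step N * d k := by
  simp only [rampSum, Finset.mul_sum]
  rw [← Finset.sum_sub_distrib, ← Finset.sum_add_distrib, Finset.sum_eq_single k]
  · have h := ramp_second_difference (step_pos hN).le k k
    rw [if_pos rfl] at h
    linear_combination d k * h
  · intro γ _ hγ
    have h := ramp_second_difference (step_pos hN).le γ k
    rw [if_neg (Fin.val_ne_of_ne hγ)] at h
    linear_combination d γ * h
  · exact fun hk => absurd (Finset.mem_univ k) hk

theorem rampSum_of_one_le (hN : N ≠ 0) (d : Fin (N + 1) → ℝ) {s : ℝ} (hs : 1 ≤ s) :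
    rampSum N d s = 0 :=
  Finset.sum_eq_zero fun β _ => by
    rw [ramp_of_le ((step_mul_mem_Icc hN β).2.trans hs), mul_zero]

theorem eq_zero_of_eqOn_rampSum (hN : N ≠ 0) (h₀ : ∑ γ, d γ = 0)
    (h : EqOn (rampSum N d) 0 (Icc 0 1)) : d = 0 := by
  have hzero {s : ℝ} (hs : 0 ≤ s) : rampSum N d s = 0 :=
    (le_total s 1).elim (fun hs₁ => h ⟨hs, hs₁⟩) (rampSum_of_one_le hN d)
  have hh := step_pos hN
  have hsucc (i : Fin N) : d i.succ = 0 := by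
    have hdiff := rampSum_second_difference hN d i.succ
    rw [Fin.val_succ, Nat.cast_succ, add_sub_cancel_right, hzero (by positivity),
      hzero (by positivity), hzero (by positivity), mul_zero, sub_zero, add_zero] at hdiff
    exact (mul_eq_zero.1 hdiff.symm).resolve_left hh.ne'
  rw [Fin.sum_univ_succ, Finset.sum_eq_zero fun i _ => hsucc i, add_zero] at h₀
  exact funext fun β => Fin.cases h₀ hsucc β

theorem eq_zero_of_integral_rampSum_sq_eq_zero (hN : N ≠ 0) (h₀ : ∑ γ, d γ = 0)
    (h : ∫ s in Ioo (0 : ℝ) 1, rampSum N d s ^ 2 = 0) : d = 0 := by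
  have hcont := continuous_rampSum d
  have hsq := (integral_eq_zero_iff_of_nonneg (fun s => sq_nonneg (rampSum N d s))
    (memLp_two_of_continuous hcont).integrable_sq).1 h
  rw [Measure.restrict_congr_set Ioo_ae_eq_Icc] at hsq
  refine eq_zero_of_eqOn_rampSum hN h₀ (Measure.eqOn_Icc_of_ae_eq volume (zero_ne_one' ℝ) ?_
    hcont.continuousOn continuousOn_const)
  filter_upwards [hsq] with s hs
  exact pow_eq_zero_iff two_ne_zero |>.1 hs

theorem SolvesSystem.errorNorm_le_iff (hC : SolvesSystem N t C p₁ p₀) (hN : N ≠ 0) (ht₀ : 0 < t)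
    (ht₁ : t < 1) (hC' : IsExactOnAffine N t C') :
    errorNorm N t C' ≤ errorNorm N t C ↔ C' = C := by
  refine ⟨fun hle => ?_, fun h => h ▸ le_rfl⟩
  rw [hC.isExactOnAffine.errorNorm_eq hN ht₀ ht₁, hC'.errorNorm_eq hN ht₀ ht₁,
    eLpNorm_two_eq_ofReal_sqrt (memLp_errorKernel ht₁ C),
    eLpNorm_two_eq_ofReal_sqrt (memLp_errorKernel ht₁ C'),
    ENNReal.ofReal_le_ofReal_iff (Real.sqrt_nonneg _),
    Real.sqrt_le_sqrt_iff (integral_nonneg fun s => sq_nonneg _),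
    hC.integral_errorKernel_sq hN ht₀ ht₁ hC', add_le_iff_nonpos_right] at hle
  refine sub_eq_zero.1 (eq_zero_of_integral_rampSum_sq_eq_zero hN ?_
    (hle.antisymm (integral_nonneg fun s => sq_nonneg _)))
  simp [Finset.sum_sub_distrib, hC'.sum_eq, hC.eq_g₀]

theorem SolvesSystem.isSardOptimal (hC : SolvesSystem N t C p₁ p₀) (hN : N ≠ 0) (ht₀ : 0 < t)
    (ht₁ : t < 1) : IsSardOptimal N t C := by
  refine ⟨hC.isExactOnAffine.errorNorm_lt_top hN ht₀ ht₁, fun C' => ?_⟩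
  rcases eq_top_or_lt_top (errorNorm N t C') with htop | hlt
  · exact htop ▸ le_top
  · by_contra! hlt'
    rw [(hC.errorNorm_le_iff hN ht₀ ht₁ (isExactOnAffine_of_errorNorm_lt_top hN ht₀ ht₁ hlt)).1
      hlt'.le] at hlt'
    exact hlt'.false

theorem SolvesSystem.isSardOptimal_iff (hC : SolvesSystem N t C p₁ p₀) (hN : N ≠ 0) (ht₀ : 0 < t)
    (ht₁ : t < 1) : IsSardOptimal N t C' ↔ C' = C :=
  ⟨fun h => (hC.errorNorm_le_iff hN ht₀ ht₁
    (isExactOnAffine_of_errorNorm_lt_top hN ht₀ ht₁ h.1)).1 (h.2 C),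
    fun h => h ▸ hC.isSardOptimal hN ht₀ ht₁⟩

theorem SolvesSystem.unique (hC : SolvesSystem N t C p₁ p₀) (hC' : SolvesSystem N t C' p₁' p₀')
    (hN : N ≠ 0) (ht₀ : 0 < t) (ht₁ : t < 1) : C' = C ∧ p₁' = p₁ ∧ p₀' = p₀ := by
  obtain rfl : C' = C := (hC.isSardOptimal_iff hN ht₀ ht₁).1 (hC'.isSardOptimal hN ht₀ ht₁)
  have haffine (β : Fin (N + 1)) :
      p₁' * (step N * (β : ℕ)) + p₀' = p₁ * (step N * (β : ℕ)) + p₀ := by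
    have heq := (hC'.eq_f β).trans (hC.eq_f β).symm
    simp only [u] at heq
    linarith
  have h₀ : p₀' = p₀ := by simpa using haffine 0
  have h₁ := haffine (Fin.last N)
  rw [Fin.val_last, step_mul_cast hN, h₀] at h₁
  exact ⟨rfl, by linarith, h₀⟩

end Optimality

/-! ### The discrete spline operator and its Green's function -/

section SplineOperator

variable {v w : ℤ → ℝ} {k : ℤ}

/-- The operator on sequences that turns the coefficients `C` of `∑ γ, C γ * |y - γ| ^ 3` into
half the fourth differences of this spline. -/
def splineOp (v : ℤ → ℝ) (k : ℤ) : ℝ :=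
  v (k - 1) + 4 * v k + v (k + 1)

/-- The central fourth difference. -/
def fourthDiff (v : ℤ → ℝ) (k : ℤ) : ℝ :=
  v (k - 2) - 4 * v (k - 1) + 6 * v k - 4 * v (k + 1) + v (k + 2)

/-- The quotient in the division of the fourth difference by `splineOp`, see
`fourthDiff_eq_splineOp_splineQuot`. -/
def splineQuot (v : ℤ → ℝ) (k : ℤ) : ℝ :=
  v (k - 1) - 8 * v k + v (k + 1)

theorem fourthDiff_eq_splineOp_splineQuot (v : ℤ → ℝ) (k : ℤ) :
    fourthDiff v k = splineOp (splineQuot v) k + 36 * v k := by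
  simp only [fourthDiff, splineOp, splineQuot, sub_add_cancel, add_sub_cancel_right, sub_sub,
    add_assoc, one_add_one_eq_two]
  ring

theorem fourthDiff_add (v w : ℤ → ℝ) (k : ℤ) :
    fourthDiff (fun j => v j + w j) k = fourthDiff v k + fourthDiff w k := by
  simp only [fourthDiff]
  ring

theorem fourthDiff_cubic (a b c d h : ℝ) (k : ℤ) :
    fourthDiff (fun j => a * (h * j) ^ 3 + b * (h * j) ^ 2 + c * (h * j) + d) k = 0 := by
  simp only [fourthDiff]
  push_cast
  ring

theorem eq_of_fourthDiff_eq (h : ∀ k, fourthDiff v k = fourthDiff w k)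
    (h₀ : ∀ k ≤ 0, v k = w k) (k : ℤ) : v k = w k := by
  suffices key : ∀ n : ℕ, ∀ j : ℤ, j ≤ n → v j = w j from key k.toNat k (Int.self_le_toNat k)
  intro n
  induction n with
  | zero => exact fun j hj => h₀ j (by simpa using hj)
  | succ n ih =>
    intro j hj
    rcases hj.lt_or_eq with hlt | rfl
    · exact ih j (by push_cast at hlt; omega)
    · have hn := h ((n : ℤ) - 1)
      simp only [fourthDiff] at hn
      rw [ih _ (by omega), ih _ (by omega), ih ((n : ℤ) - 1) (by omega), ih _ (by omega),
        show (n : ℤ) - 1 + 2 = (n + 1 : ℕ) by push_cast; ring] at hn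
      linarith

theorem q_sq : q ^ 2 = -4 * q - 1 := by
  have h : √3 ^ 2 = (3 : ℝ) := Real.sq_sqrt (by norm_num)
  unfold q
  linear_combination h

theorem q_mem_Ioo : q ∈ Ioo (-(1 / 2) : ℝ) 0 := by
  have h₁ : (3 / 2 : ℝ) < √3 := Real.lt_sqrt_of_sq_lt (by norm_num)
  have h₂ : √3 < 2 := (Real.sqrt_lt' (by norm_num)).2 (by norm_num)
  unfold q
  exact ⟨by linarith, by linarith⟩

theorem q_ne_zero : q ≠ 0 :=
  q_mem_Ioo.2.ne

theorem q_inv : q⁻¹ = -4 - q :=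
  inv_eq_of_mul_eq_one_right (by linear_combination -q_sq)

theorem splineOp_zpow (k : ℤ) : splineOp (fun j => q ^ j) k = 0 := by
  simp only [splineOp, zpow_sub_one₀ q_ne_zero, zpow_add_one₀ q_ne_zero, q_inv]
  ring

theorem splineOp_zpow_sub (n k : ℤ) : splineOp (fun j => q ^ (n - j)) k = 0 := by
  simp only [splineOp, ← sub_add, ← sub_sub, zpow_sub_one₀ q_ne_zero, zpow_add_one₀ q_ne_zero,
    q_inv]
  ring

theorem splineOp_pow_natAbs (k : ℤ) :
    splineOp (fun j => q ^ j.natAbs) k = if k = 0 then 2 * (q + 2) else 0 := by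
  rcases lt_trichotomy k 0 with hk | rfl | hk
  · obtain ⟨n, rfl⟩ : ∃ n : ℕ, k = -(n + 1) := ⟨(-k - 1).toNat, by omega⟩
    rw [if_neg hk.ne, splineOp, show (-((n : ℤ) + 1) - 1).natAbs = n + 2 by omega,
      show (-((n : ℤ) + 1)).natAbs = n + 1 by omega, show (-((n : ℤ) + 1) + 1).natAbs = n by omega]
    linear_combination q ^ n * q_sq
  · norm_num [splineOp]
    ring
  · obtain ⟨n, rfl⟩ : ∃ n : ℕ, k = n + 1 := ⟨(k - 1).toNat, by omega⟩
    rw [if_neg hk.ne', splineOp, show ((n : ℤ) + 1 - 1).natAbs = n by omega,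
      show ((n : ℤ) + 1).natAbs = n + 1 by omega, show ((n : ℤ) + 1 + 1).natAbs = n + 2 by omega]
    linear_combination q ^ n * q_sq

theorem splineOp_sum_pow_natAbs_mul {n : ℕ} (F : ℕ → ℝ) {k : ℕ} (hk : k ≤ n) :
    splineOp (fun j => ∑ γ ∈ Finset.range (n + 1), q ^ (j - γ).natAbs * F γ) k =
      2 * (q + 2) * F k := by
  have hterm (γ : ℕ) : splineOp (fun j => q ^ (j - (γ : ℤ)).natAbs * F γ) k =
      if k = γ then 2 * (q + 2) * F γ else 0 := by
    have h := splineOp_pow_natAbs ((k : ℤ) - γ)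
    simp only [sub_eq_zero, Nat.cast_inj] at h
    simp only [splineOp, sub_right_comm _ (1 : ℤ), add_sub_right_comm] at h ⊢
    rw [← zero_mul (F γ), ← ite_mul, ← h]
    ring
  calc _ = ∑ γ ∈ Finset.range (n + 1), splineOp (fun j => q ^ (j - (γ : ℤ)).natAbs * F γ) k := by
        simp only [splineOp, Finset.sum_add_distrib, Finset.mul_sum]
    _ = 2 * (q + 2) * F k := by
        simp only [hterm, Finset.sum_ite_eq, Finset.mem_range, Nat.lt_succ_iff.2 hk, if_true]

theorem sum_pow_natAbs_mul {n k : ℕ} (x : ℝ) (F : ℕ → ℝ) (hk : k ≤ n) :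
    ∑ γ ∈ Finset.range (n + 1), x ^ ((k : ℤ) - γ).natAbs * F γ =
      (∑ γ ∈ Finset.range k, x ^ (k - γ) * F γ) + F k +
        ∑ γ ∈ Finset.Icc (k + 1) n, x ^ (γ - k) * F γ := by
  rw [← Finset.sum_range_add_sum_Ico _ (by omega : k + 1 ≤ n + 1), Finset.sum_range_succ]
  congr 1
  · congr 1
    · refine Finset.sum_congr rfl fun γ hγ => ?_
      rw [show ((k : ℤ) - γ).natAbs = k - γ by have := Finset.mem_range.1 hγ; omega]
    · simp
  · refine Finset.sum_congr (by ext; simp) fun γ hγ => ?_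
    rw [show ((k : ℤ) - γ).natAbs = γ - k by have := (Finset.mem_Icc.1 hγ).1; omega]

theorem fourthDiff_abs_sub_cubed (m k : ℤ) :
    fourthDiff (fun j => |(j : ℝ) - m| ^ 3) k =
      2 * splineOp (fun j => if j = m then 1 else 0) k := by
  obtain ⟨n, rfl⟩ : ∃ n, k = m + n := ⟨k - m, by ring⟩
  simp only [fourthDiff, splineOp, add_sub_assoc, add_assoc, add_eq_left]
  push_cast
  simp only [add_sub_cancel_left]
  obtain hn | rfl | rfl | rfl | hn : n ≤ -2 ∨ n = -1 ∨ n = 0 ∨ n = 1 ∨ 2 ≤ n := by omega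
  · have hn' : (n : ℝ) ≤ -2 := by exact_mod_cast hn
    rw [if_neg (by omega), if_neg (by omega), if_neg (by omega), abs_of_nonpos (by linarith),
      abs_of_nonpos (by linarith), abs_of_nonpos (by linarith), abs_of_nonpos (by linarith),
      abs_of_nonpos (by linarith)]
    ring
  · norm_num
  · norm_num
  · norm_num
  · have hn' : (2 : ℝ) ≤ n := by exact_mod_cast hn
    rw [if_neg (by omega), if_neg (by omega), if_neg (by omega), abs_of_nonneg (by linarith),
      abs_of_nonneg (by linarith), abs_of_nonneg (by linarith), abs_of_nonneg (by linarith),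
      abs_of_nonneg (by linarith)]
    ring

end SplineOperator

/-! ### The explicit coefficients -/

section Coefficients

variable {N : ℕ} {t : ℝ} {k : ℤ}

theorem Δ_ne_zero (hN : N ≠ 0) : Δ N ≠ 0 := by
  obtain ⟨hq₁, hq₂⟩ := q_mem_Ioo
  have hpow : |q ^ N| < 1 := by
    rw [abs_pow]
    exact pow_lt_one₀ (abs_nonneg _) (abs_lt.2 ⟨by linarith, by linarith⟩) hN
  have hfactor : Δ N = (step N * (2 * q + 1)) ^ 2 * ((q ^ N) ^ 2 - 1) := by
    unfold Δ B₂ A₂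
    ring
  rw [hfactor]
  exact mul_ne_zero (pow_ne_zero _ (mul_pos (step_pos hN) (by linarith)).ne')
    (sub_neg.2 ((sq_lt_one_iff_abs_lt_one _).2 hpow)).ne

theorem a₁_relation_left (hN : N ≠ 0) (t : ℝ) :
    -A₂ N * a₁neg N t + B₂ N * a₁pos N t = R₁ N t := by
  rw [a₁neg, a₁pos, mul_div_assoc', mul_div_assoc', ← add_div, div_eq_iff (Δ_ne_zero hN), Δ, Δ₁, Δ₂]
  ring

theorem a₁_relation_right (hN : N ≠ 0) (t : ℝ) :
    -B₂ N * a₁neg N t + A₂ N * a₁pos N t = R₂ N t := by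
  rw [a₁neg, a₁pos, mul_div_assoc', mul_div_assoc', ← add_div, div_eq_iff (Δ_ne_zero hN), Δ, Δ₁, Δ₂]
  ring

/-- The cubic that continues the grid values of `f` to the left of `0`. -/
noncomputable def leftCubic (N : ℕ) (t y : ℝ) : ℝ :=
  -(1 / 12) * y ^ 3 * g₀ t + (1 / 4) * y ^ 2 * g₁ t + a₁neg N t * y + a₀neg t

/-- The cubic that continues the grid values of `f` to the right of `1`. -/
noncomputable def rightCubic (N : ℕ) (t y : ℝ) : ℝ :=
  (1 / 12) * y ^ 3 * g₀ t - (1 / 4) * y ^ 2 * g₁ t + a₁pos N t * y + a₀pos N t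

/-- The values on the whole grid `hℤ` of the spline `u` belonging to the optimal coefficients:
those of `f` on `[0,1]`, continued by the two cubics. -/
noncomputable def gridValue (N : ℕ) (t : ℝ) (k : ℤ) : ℝ :=
  if k < 0 then leftCubic N t (step N * k)
  else if k ≤ N then f (step N * k) t
  else rightCubic N t (step N * k)

theorem gridValue_of_nonpos (hk : k ≤ 0) : gridValue N t k = leftCubic N t (step N * k) := by
  rcases hk.lt_or_eq with h | rfl
  · simp [gridValue, h]
  · simp [gridValue, leftCubic, a₀neg]

theorem gridValue_natCast {n : ℕ} (hn : n ≤ N) : gridValue N t n = f (step N * n) t := by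
  simp [gridValue, hn]

theorem gridValue_of_ge (hN : N ≠ 0) (hk : (N : ℤ) ≤ k) :
    gridValue N t k = rightCubic N t (step N * k) := by
  rcases hk.lt_or_eq with h | rfl
  · simp [gridValue, not_le.2 h, not_lt.2 ((Int.natCast_nonneg N).trans hk)]
  · rw [gridValue_natCast le_rfl, Int.cast_natCast, step_mul_cast hN, rightCubic, a₀pos, a₁pos]
    ring

/-- The contribution `6 (q + 2) ∑_{j ≥ 1} q ^ j * p (-h j)` of the left cubic `p` to the
convolution of the grid values with `6 * (q + 2) * q ^ |k|` at `0`, in closed form. -/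
noncomputable def leftTail (N : ℕ) (t : ℝ) : ℝ :=
  a₁neg N t * step N * (q + 2) - 3 * f 0 t * (q + 1) - g₁ t / 4 * step N ^ 2

/-- The contribution `6 (q + 2) ∑_{j ≥ 1} q ^ j * p (1 + h j)` of the right cubic `p` to the
convolution of the grid values with `6 * (q + 2) * q ^ |k|` at `N`, in closed form. -/
noncomputable def rightTail (N : ℕ) (t : ℝ) : ℝ :=
  g₁ t / 4 * (2 * step N * (q + 2) + step N ^ 2) -
    (3 * f 1 t * (q + 1) + g₀ t / 4 * (step N * (q + 2) + step N ^ 2) +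
      a₁pos N t * step N * (q + 2))

/-- The convolution of the grid values with `6 * (q + 2) * q ^ |k|`, which is `36` times the Green's
function of `splineOp`, for `0 ≤ k ≤ N`; the values outside `[0,1]` enter through the two tails. -/
noncomputable def gridConv (N : ℕ) (t : ℝ) (k : ℤ) : ℝ :=
  6 * (q + 2) * (∑ γ ∈ Finset.range (N + 1), q ^ (k - γ).natAbs * f (step N * γ) t) +
    leftTail N t * q ^ k + rightTail N t * q ^ ((N : ℤ) - k)

theorem splineOp_gridConv {n : ℕ} (hn : n ≤ N) :
    splineOp (gridConv N t) n = 36 * f (step N * n) t := by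
  have hsum := splineOp_sum_pow_natAbs_mul (fun γ => f (step N * γ) t) hn
  have hleft := splineOp_zpow n
  have hright := splineOp_zpow_sub N n
  simp only [splineOp, gridConv] at hsum hleft hright ⊢
  linear_combination 6 * (q + 2) * hsum + leftTail N t * hleft + rightTail N t * hright +
    12 * f (step N * n) t * q_sq

theorem gridConv_natCast {n : ℕ} (hn : n ≤ N) : gridConv N t n =
    6 * (q + 2) * ((∑ γ ∈ Finset.range n, q ^ (n - γ) * f (step N * γ) t) + f (step N * n) t +
      ∑ γ ∈ Finset.Icc (n + 1) N, q ^ (γ - n) * f (step N * γ) t) +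
      leftTail N t * q ^ n + rightTail N t * q ^ (N - n) := by
  rw [gridConv, sum_pow_natAbs_mul q (fun γ => f (step N * γ) t) hn, zpow_natCast,
    ← Nat.cast_sub hn, zpow_natCast]

theorem gridConv_zero (hN : N ≠ 0) :
    gridConv N t 0 = 6 * f 0 t - step N ^ 2 * g₁ t / 2 := by
  have hsum : ∑ γ ∈ Finset.Icc 1 N, q ^ (γ + 1) * f (step N * γ) t =
      q * ∑ γ ∈ Finset.Icc 1 N, q ^ γ * f (step N * γ) t := by
    simp only [Finset.mul_sum, pow_succ', mul_assoc]
  have hrel := a₁_relation_left hN t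
  have hconv := gridConv_natCast (t := t) N.zero_le
  simp only [Nat.cast_zero, mul_zero, Finset.range_zero, Finset.sum_empty, zero_add, pow_zero,
    Nat.sub_zero, leftTail, rightTail] at hconv
  rw [R₁, F₁, hsum, A₁, A₂, A₃, B₁, B₂, B₃] at hrel
  refine mul_left_cancel₀ q_ne_zero ?_
  rw [hconv]
  linear_combination hrel + (3 * f 0 t + a₁neg N t * step N -
    q ^ N * (3 * f 1 t + step N * (g₀ t / 4 - g₁ t / 2 + a₁pos N t))) * q_sq

theorem gridConv_last (hN : N ≠ 0) : gridConv N t N =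
    6 * f 1 t - step N ^ 2 * (g₀ t - g₁ t) / 2 := by
  have hsum : ∑ γ ∈ Finset.Icc 0 (N - 1), q ^ (N + 1 - γ) * f (step N * γ) t =
      q * ∑ γ ∈ Finset.range N, q ^ (N - γ) * f (step N * γ) t := by
    rw [Finset.mul_sum]
    refine Finset.sum_congr (by ext; simp; omega) fun γ hγ => ?_
    rw [Nat.succ_sub (Finset.mem_range.1 hγ).le, pow_succ', mul_assoc]
  have hrel := a₁_relation_right hN t
  have hconv := gridConv_natCast (t := t) le_rfl (n := N)
  simp only [Finset.Icc_eq_empty_of_lt N.lt_succ_self, Finset.sum_empty, step_mul_cast hN,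
    Nat.sub_self, pow_zero, leftTail, rightTail] at hconv
  rw [R₂, F₂, hsum, A₁, A₂, A₃, B₁, B₂, B₃] at hrel
  refine mul_left_cancel₀ q_ne_zero ?_
  rw [hconv]
  linear_combination hrel + (q ^ N * (a₁neg N t * step N - 3 * f 0 t) + 3 * f 1 t -
    step N * (g₀ t / 4 - g₁ t / 2 + a₁pos N t)) * q_sq

theorem gridConv_neg_one : gridConv N t (-1) = q * gridConv N t 0 - 2 * (q + 2) * leftTail N t := by
  have hsum : ∑ γ ∈ Finset.range (N + 1), q ^ (-1 - (γ : ℤ)).natAbs * f (step N * γ) t =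
      q * ∑ γ ∈ Finset.range (N + 1), q ^ (0 - (γ : ℤ)).natAbs * f (step N * γ) t := by
    rw [Finset.mul_sum]
    refine Finset.sum_congr rfl fun γ _ => ?_
    rw [show (-1 - (γ : ℤ)).natAbs = (0 - (γ : ℤ)).natAbs + 1 by omega, pow_succ', mul_assoc]
  rw [gridConv, gridConv, hsum, zpow_neg_one, q_inv, sub_neg_eq_add, zpow_add_one₀ q_ne_zero,
    zpow_zero, sub_zero]
  ring

theorem gridConv_last_add_one :
    gridConv N t (N + 1) = q * gridConv N t N - 2 * (q + 2) * rightTail N t := by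
  have hsum : ∑ γ ∈ Finset.range (N + 1), q ^ ((N : ℤ) + 1 - γ).natAbs * f (step N * γ) t =
      q * ∑ γ ∈ Finset.range (N + 1), q ^ ((N : ℤ) - γ).natAbs * f (step N * γ) t := by
    rw [Finset.mul_sum]
    refine Finset.sum_congr rfl fun γ hγ => ?_
    have hle := Finset.mem_range_succ_iff.1 hγ
    rw [show ((N : ℤ) + 1 - γ).natAbs = ((N : ℤ) - γ).natAbs + 1 by omega, pow_succ', mul_assoc]
  rw [gridConv, gridConv, hsum, sub_add_cancel_left, sub_self, zpow_neg_one, q_inv,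
    zpow_add_one₀ q_ne_zero, zpow_zero]
  ring

theorem gridConv_eq_left (hN : N ≠ 0) (hk : k = -1 ∨ k = 0) :
    gridConv N t k = -splineQuot (fun j => leftCubic N t (step N * j)) k := by
  rcases hk with rfl | rfl
  · rw [gridConv_neg_one, gridConv_zero hN, leftTail]
    simp only [splineQuot, leftCubic, a₀neg]
    push_cast
    linear_combination 2 * (3 * f 0 t - a₁neg N t * step N) * q_sq
  · rw [gridConv_zero hN]
    simp only [splineQuot, leftCubic, a₀neg]
    push_cast
    ring

theorem gridConv_eq_right (hN : N ≠ 0) (hk : k = N ∨ k = N + 1) :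
    gridConv N t k = -splineQuot (fun j => rightCubic N t (step N * j)) k := by
  have hcubic (j : ℤ) : rightCubic N t (step N * (N + j : ℤ)) =
      rightCubic N t (1 + step N * j) := by
    rw [← step_mul_cast hN, ← mul_add, Int.cast_add, Int.cast_natCast]
  rcases hk with rfl | rfl
  · have h₀ := hcubic 0
    rw [gridConv_last hN]
    simp only [splineQuot, hcubic, sub_eq_add_neg, add_assoc]
    rw [add_zero] at h₀
    rw [h₀]
    simp only [rightCubic, a₀pos, a₁pos]
    push_cast
    ring
  · rw [gridConv_last_add_one, gridConv_last hN, rightTail]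
    simp only [splineQuot, sub_eq_add_neg, add_assoc, hcubic]
    simp only [rightCubic, a₀pos, a₁pos]
    push_cast
    linear_combination (6 * f 1 t + step N * (g₀ t / 2 - g₁ t + 2 * (Δ₂ N t / Δ N))) * q_sq

theorem sum_Icc_eq_add_sum_Icc_succ {m n : ℕ} (hmn : m ≤ n) (F : ℕ → ℝ) :
    ∑ γ ∈ Finset.Icc m n, F γ = F m + ∑ γ ∈ Finset.Icc (m + 1) n, F γ := by
  rw [← Finset.insert_Icc_add_one_left_eq_Icc hmn, Finset.sum_insert (by simp)]

theorem step_cubed_mul_cancel (hN : N ≠ 0) (x : ℝ) :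
    step N ^ 3 / 6 * (6 / step N ^ 3 * x) = x := by
  have := (step_pos hN).ne'
  field_simp

theorem coeffFirst_eq (hN : N ≠ 0) :
    step N ^ 3 / 6 * coeffFirst N t = splineQuot (gridValue N t) 0 + gridConv N t 0 := by
  have hN₁ : 1 ≤ N := Nat.one_le_iff_ne_zero.2 hN
  have hconv := gridConv_natCast (t := t) N.zero_le
  rw [zero_add, sum_Icc_eq_add_sum_Icc_succ hN₁, Nat.cast_zero] at hconv
  have hnext : gridValue N t (0 + 1) = f (step N) t := by simpa using gridValue_natCast (t := t) hN₁
  rw [coeffFirst, step_cubed_mul_cancel hN, splineQuot, hnext, gridValue_of_nonpos (by simp),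
    gridValue_of_nonpos le_rfl, hconv]
  simp only [leftCubic, a₀neg, leftTail, rightTail, Finset.range_zero, Finset.sum_empty,
    Nat.sub_zero, pow_zero, pow_one, Nat.cast_zero, Nat.cast_one, Int.cast_zero, mul_zero, mul_one]
  push_cast
  linear_combination -6 * f (step N) t * q_sq

theorem coeffLast_eq (hN : N ≠ 0) :
    step N ^ 3 / 6 * coeffLast N t = splineQuot (gridValue N t) N + gridConv N t N := by
  obtain ⟨M, rfl⟩ : ∃ M, N = M + 1 := Nat.exists_eq_succ_of_ne_zero hN
  have hprev : step (M + 1) * (M : ℝ) = 1 - step (M + 1) := by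
    linear_combination (by simpa using step_mul_cast hN : step (M + 1) * ((M : ℝ) + 1) = 1)
  have hnext : step (M + 1) * (((M + 1 : ℕ) + 1 : ℤ) : ℝ) = 1 + step (M + 1) := by
    push_cast
    linear_combination hprev
  have hval : gridValue (M + 1) t ((M + 1 : ℕ) - 1) = f (1 - step (M + 1)) t := by
    rw [← hprev, ← gridValue_natCast M.le_succ]
    simp
  have hconv := gridConv_natCast (t := t) (le_refl (M + 1))
  rw [Finset.sum_range_succ, hprev, step_mul_cast hN] at hconv
  rw [coeffLast, step_cubed_mul_cancel hN, splineQuot, hval, gridValue_natCast le_rfl,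
    gridValue_of_ge hN (by simp), hconv, hnext, step_mul_cast hN]
  simp only [rightCubic, a₀pos, a₁pos, leftTail, rightTail, Nat.add_sub_cancel,
    Nat.add_sub_cancel_left, pow_one, Nat.sub_self, pow_zero,
    Finset.Icc_eq_empty_of_lt (M + 1).lt_succ_self, Finset.sum_empty]
  linear_combination (-6 * f (1 - step (M + 1)) t) * q_sq

theorem coeffMiddle_eq {b : ℕ} (hb : b + 1 < N) :
    step N ^ 3 / 6 * coeffMiddle N t (b + 1) =
      splineQuot (gridValue N t) (b + 1 : ℕ) + gridConv N t (b + 1 : ℕ) := by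
  have hconv := gridConv_natCast (t := t) hb.le
  rw [Finset.sum_range_succ, sum_Icc_eq_add_sum_Icc_succ hb, Nat.succ_eq_add_one] at hconv
  have hprev : gridValue N t ((b + 1 : ℕ) - 1) = f (step N * b) t := by
    rw [← gridValue_natCast (by omega)]
    simp
  have hnext : gridValue N t ((b + 1 : ℕ) + 1) = f (step N * (b + 1 + 1 : ℕ)) t :=
    gridValue_natCast hb
  rw [coeffMiddle, step_cubed_mul_cancel hb.ne_bot, splineQuot, hprev, hnext,
    gridValue_natCast hb.le, hconv]
  simp only [leftTail, rightTail, Nat.add_sub_cancel, Nat.add_sub_cancel_left, pow_one,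
    Nat.cast_add, Nat.cast_one, add_sub_cancel_right]
  linear_combination (-6 * f (step N * b) t - 6 * f (step N * (b + 1 + 1)) t) * q_sq

/-- The extension by zero of a coefficient vector to the whole grid. -/
noncomputable def extendedCoeff (N : ℕ) (C : Fin (N + 1) → ℝ) (k : ℤ) : ℝ :=
  ∑ γ : Fin (N + 1), if k = (γ : ℕ) then C γ else 0

theorem extendedCoeff_natCast (C : Fin (N + 1) → ℝ) (β : Fin (N + 1)) :
    extendedCoeff N C (β : ℕ) = C β := by
  simp [extendedCoeff, Fin.val_inj]

theorem extendedCoeff_of_notMem (C : Fin (N + 1) → ℝ) (hk : k < 0 ∨ (N : ℤ) < k) :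
    extendedCoeff N C k = 0 :=
  Finset.sum_eq_zero fun γ _ => if_neg (by omega)

theorem extendedCoeff_coeff_natCast (hN : N ≠ 0) {n : ℕ} (hn : n ≤ N) :
    step N ^ 3 / 6 * extendedCoeff N (coeff N t) n =
      splineQuot (gridValue N t) n + gridConv N t n := by
  rw [extendedCoeff_natCast _ ⟨n, Nat.lt_succ_iff.2 hn⟩, coeff]
  split_ifs with h₀ h₁
  · obtain rfl : n = 0 := h₀
    exact_mod_cast coeffFirst_eq hN
  · obtain rfl : n = N := h₁
    exact coeffLast_eq hN
  · obtain ⟨b, rfl⟩ : ∃ b, n = b + 1 := Nat.exists_eq_succ_of_ne_zero h₀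
    exact coeffMiddle_eq (lt_of_le_of_ne hn h₁)

theorem extendedCoeff_coeff_of_nonpos (hN : N ≠ 0) (hk : k ≤ 0) :
    step N ^ 3 / 6 * extendedCoeff N (coeff N t) k = splineQuot (gridValue N t) k -
      splineQuot (fun j => leftCubic N t (step N * j)) k := by
  rcases hk.lt_or_eq with hk | rfl
  · simp only [extendedCoeff_of_notMem _ (Or.inl hk), splineQuot,
      gridValue_of_nonpos (by omega : k - 1 ≤ 0), gridValue_of_nonpos hk.le,
      gridValue_of_nonpos (by omega : k + 1 ≤ 0)]
    ring
  · rw [sub_eq_add_neg, ← gridConv_eq_left hN (Or.inr rfl)]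
    exact_mod_cast extendedCoeff_coeff_natCast hN N.zero_le

theorem extendedCoeff_coeff_of_ge (hN : N ≠ 0) (hk : (N : ℤ) ≤ k) :
    step N ^ 3 / 6 * extendedCoeff N (coeff N t) k = splineQuot (gridValue N t) k -
      splineQuot (fun j => rightCubic N t (step N * j)) k := by
  rcases hk.lt_or_eq with hk | rfl
  · simp only [extendedCoeff_of_notMem _ (Or.inr hk), splineQuot,
      gridValue_of_ge hN (by omega : (N : ℤ) ≤ k - 1), gridValue_of_ge hN hk.le,
      gridValue_of_ge hN (by omega : (N : ℤ) ≤ k + 1)]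
    ring
  · rw [sub_eq_add_neg, ← gridConv_eq_right hN (Or.inl rfl)]
    exact extendedCoeff_coeff_natCast hN le_rfl

theorem extendedCoeff_coeff_of_mem (hN : N ≠ 0) (hk₀ : -1 ≤ k) (hk₁ : k ≤ N + 1) :
    step N ^ 3 / 6 * extendedCoeff N (coeff N t) k =
      splineQuot (gridValue N t) k + gridConv N t k := by
  obtain rfl | rfl | ⟨hk₀, hk₁⟩ : k = -1 ∨ k = N + 1 ∨ 0 ≤ k ∧ k < N + 1 := by omega
  · rw [extendedCoeff_coeff_of_nonpos hN (by simp), gridConv_eq_left hN (Or.inl rfl),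
      sub_eq_add_neg]
  · rw [extendedCoeff_coeff_of_ge hN (by simp), gridConv_eq_right hN (Or.inr rfl), sub_eq_add_neg]
  · lift k to ℕ using hk₀
    exact extendedCoeff_coeff_natCast hN (by omega)

theorem fourthDiff_leftCubic (k : ℤ) :
    fourthDiff (fun j => leftCubic N t (step N * j)) k = 0 := by
  simp only [fourthDiff, leftCubic]
  push_cast
  ring

theorem fourthDiff_rightCubic (k : ℤ) :
    fourthDiff (fun j => rightCubic N t (step N * j)) k = 0 := by
  simp only [fourthDiff, rightCubic]
  push_cast
  ring

theorem fourthDiff_gridValue (hN : N ≠ 0) (k : ℤ) :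
    fourthDiff (gridValue N t) k =
      step N ^ 3 / 6 * splineOp (extendedCoeff N (coeff N t)) k := by
  rw [fourthDiff_eq_splineOp_splineQuot, splineOp, splineOp]
  obtain hk | hk | ⟨hk₀, hk₁⟩ : k < 0 ∨ (N : ℤ) < k ∨ 0 ≤ k ∧ k ≤ N := by omega
  · have hcubic := fourthDiff_leftCubic (N := N) (t := t) k
    rw [fourthDiff_eq_splineOp_splineQuot, splineOp, ← gridValue_of_nonpos hk.le] at hcubic
    have hc {j : ℤ} := extendedCoeff_coeff_of_nonpos (t := t) (k := j) hN
    linear_combination hcubic - hc (by omega : k - 1 ≤ 0) - 4 * hc hk.le -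
      hc (by omega : k + 1 ≤ 0)
  · have hcubic := fourthDiff_rightCubic (N := N) (t := t) k
    rw [fourthDiff_eq_splineOp_splineQuot, splineOp, ← gridValue_of_ge hN hk.le] at hcubic
    have hc {j : ℤ} := extendedCoeff_coeff_of_ge (t := t) (k := j) hN
    linear_combination hcubic - hc (by omega : (N : ℤ) ≤ k - 1) - 4 * hc hk.le -
      hc (by omega : (N : ℤ) ≤ k + 1)
  · lift k to ℕ using hk₀
    have hn : k ≤ N := by exact_mod_cast hk₁
    have hconv := splineOp_gridConv (t := t) hn
    rw [splineOp, ← gridValue_natCast hn] at hconv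
    have hc {j : ℤ} := extendedCoeff_coeff_of_mem (t := t) (k := j) hN
    linear_combination -hconv - hc (by omega : -1 ≤ (k : ℤ) - 1) (by omega) -
      4 * hc (by omega : -1 ≤ (k : ℤ)) (by omega) - hc (by omega : -1 ≤ (k : ℤ) + 1) (by omega)

end Coefficients

/-! ### The spline with the explicit coefficients -/

section ExplicitSpline

variable {N : ℕ} {t y : ℝ} {k : ℤ}

theorem fourthDiff_u (hN : N ≠ 0) (C : Fin (N + 1) → ℝ) (p₁ p₀ : ℝ) (k : ℤ) :
    fourthDiff (fun j => u N C p₁ p₀ (step N * j)) k =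
      step N ^ 3 / 6 * splineOp (extendedCoeff N C) k := by
  have hscale (γ : Fin (N + 1)) (j : ℤ) : C γ * (|step N * j - step N * (γ : ℕ)| ^ 3 / 12) =
      step N ^ 3 / 12 * (C γ * |(j : ℝ) - ((γ : ℕ) : ℤ)| ^ 3) := by
    rw [← mul_sub, abs_mul, abs_of_pos (step_pos hN), mul_pow, Int.cast_natCast]
    ring
  calc fourthDiff (fun j => u N C p₁ p₀ (step N * j)) k
      = step N ^ 3 / 12 * ∑ γ : Fin (N + 1), C γ *
          fourthDiff (fun j => |(j : ℝ) - ((γ : ℕ) : ℤ)| ^ 3) k := by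
        simp only [fourthDiff, u, hscale, mul_add, mul_sub, Finset.sum_add_distrib,
          Finset.sum_sub_distrib, mul_left_comm (C _), ← Finset.mul_sum]
        push_cast
        ring
    _ = step N ^ 3 / 6 * splineOp (extendedCoeff N C) k := by
        simp only [fourthDiff_abs_sub_cubed, splineOp, extendedCoeff, ← mul_boole _ (C _), mul_add,
          Finset.sum_add_distrib, mul_left_comm (C _), ← Finset.mul_sum]
        simp only [mul_comm (C _)]
        ring

theorem u_of_nonpos (C : Fin (N + 1) → ℝ) (p₁ p₀ : ℝ) (hy : y ≤ 0) :
    u N C p₁ p₀ y = (∑ γ, C γ * ((step N * (γ : ℕ) - y) ^ 3 / 12)) + p₁ * y + p₀ := by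
  have hnode (γ : Fin (N + 1)) : 0 ≤ step N * (γ : ℕ) := by
    unfold step
    positivity
  simp only [u, abs_of_nonpos (sub_nonpos.2 (hy.trans (hnode _))), neg_sub]

theorem u_of_one_le (hN : N ≠ 0) (C : Fin (N + 1) → ℝ) (p₁ p₀ : ℝ) (hy : 1 ≤ y) :
    u N C p₁ p₀ y = -(∑ γ, C γ * ((step N * (γ : ℕ) - y) ^ 3 / 12)) + p₁ * y + p₀ := by
  simp only [u, abs_of_nonneg (sub_nonneg.2 ((step_mul_mem_Icc hN _).2.trans hy)),
    ← Finset.sum_neg_distrib]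
  congr 2
  exact Finset.sum_congr rfl fun γ _ => by ring

theorem sum_mul_sub_cubed {ι : Type*} [Fintype ι] (C x : ι → ℝ) (y : ℝ) :
    ∑ i, C i * ((x i - y) ^ 3 / 12) =
      -(∑ i, C i) / 12 * y ^ 3 + (∑ i, C i * x i) / 4 * y ^ 2 +
        -(∑ i, C i * x i ^ 2) / 4 * y + (∑ i, C i * x i ^ 3) / 12 := by
  simp only [← Finset.sum_neg_distrib, Finset.sum_div, Finset.sum_mul, ← Finset.sum_add_distrib]
  exact Finset.sum_congr rfl fun i _ => by ring

theorem cubic_eq_zero_of_arith_prog {a b c d x h : ℝ} (hh : h ≠ 0)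
    (hz : ∀ j : ℕ, a * (x + h * j) ^ 3 + b * (x + h * j) ^ 2 + c * (x + h * j) + d = 0) :
    a = 0 ∧ b = 0 ∧ c = 0 ∧ d = 0 := by
  have z₀ := hz 0
  have z₁ := hz 1
  have z₂ := hz 2
  have z₃ := hz 3
  push_cast at z₀ z₁ z₂ z₃
  obtain rfl : a = 0 := (mul_eq_zero.1 (by linear_combination (z₃ - 3 * z₂ + 3 * z₁ - z₀) / 6 :
    a * h ^ 3 = 0)).resolve_right (pow_ne_zero _ hh)
  obtain rfl : b = 0 := (mul_eq_zero.1 (by linear_combination (z₂ - 2 * z₁ + z₀) / 2 :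
    b * h ^ 2 = 0)).resolve_right (pow_ne_zero _ hh)
  obtain rfl : c = 0 := (mul_eq_zero.1 (by linear_combination z₁ - z₀ :
    c * h = 0)).resolve_right hh
  exact ⟨rfl, rfl, rfl, by linear_combination z₀⟩

theorem rightCubic_eq_sub_leftCubic (y : ℝ) : rightCubic N t y =
    (a₁neg N t + a₁pos N t) * y + (a₀neg t + a₀pos N t) - leftCubic N t y := by
  rw [rightCubic, leftCubic]
  ring

/-- The function `u` of the linear system for the explicit values of all its unknowns. -/
noncomputable def explicitSpline (N : ℕ) (t y : ℝ) : ℝ :=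
  u N (coeff N t) ((a₁neg N t + a₁pos N t) / 2) ((a₀neg t + a₀pos N t) / 2) y

/-- The cubic by which `leftCubic` exceeds `explicitSpline` to the left of `0`; its vanishing is
what makes the explicit coefficients solve the linear system. -/
noncomputable def defectCubic (N : ℕ) (t y : ℝ) : ℝ :=
  leftCubic N t y - (∑ γ, coeff N t γ * ((step N * (γ : ℕ) - y) ^ 3 / 12)) -
    (a₁neg N t + a₁pos N t) / 2 * y - (a₀neg t + a₀pos N t) / 2

theorem defectCubic_eq (N : ℕ) (t : ℝ) : ∃ c d : ℝ, ∀ y, defectCubic N t y =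
    ((∑ γ, coeff N t γ) - g₀ t) / 12 * y ^ 3 +
      (g₁ t - ∑ γ, coeff N t γ * (step N * (γ : ℕ))) / 4 * y ^ 2 + c * y + d := by
  refine ⟨(∑ γ, coeff N t γ * (step N * (γ : ℕ)) ^ 2) / 4 + (a₁neg N t - a₁pos N t) / 2,
    (a₀neg t - a₀pos N t) / 2 - (∑ γ, coeff N t γ * (step N * (γ : ℕ)) ^ 3) / 12, fun y => ?_⟩
  rw [defectCubic, leftCubic, sum_mul_sub_cubed]
  ring

theorem gridValue_eq_explicitSpline_add_defectCubic (hN : N ≠ 0) (k : ℤ) :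
    gridValue N t k = explicitSpline N t (step N * k) + defectCubic N t (step N * k) := by
  refine eq_of_fourthDiff_eq (v := gridValue N t)
    (w := fun k => explicitSpline N t (step N * k) + defectCubic N t (step N * k))
    (fun k => ?_) (fun k hk => ?_) k
  · obtain ⟨c, d, hcubic⟩ := defectCubic_eq N t
    simp only [hcubic, explicitSpline]
    rw [fourthDiff_add, fourthDiff_u hN, fourthDiff_cubic, add_zero, fourthDiff_gridValue hN]
  · rw [gridValue_of_nonpos hk, explicitSpline, defectCubic, u_of_nonpos _ _ _
      (mul_nonpos_of_nonneg_of_nonpos (step_pos hN).le (Int.cast_nonpos.2 hk))]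
    ring

theorem defectCubic_eq_zero_of_ge (hN : N ≠ 0) (hk : (N : ℤ) ≤ k) :
    defectCubic N t (step N * k) = 0 := by
  have hy : 1 ≤ step N * k := by
    rw [← step_mul_cast hN]
    exact mul_le_mul_of_nonneg_left (by exact_mod_cast hk) (step_pos hN).le
  have hvalue := gridValue_eq_explicitSpline_add_defectCubic (t := t) hN k
  have hreflect : gridValue N t k =
      explicitSpline N t (step N * k) - defectCubic N t (step N * k) := by
    rw [gridValue_of_ge hN hk, rightCubic_eq_sub_leftCubic, explicitSpline, defectCubic,
      u_of_one_le hN _ _ _ hy]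
    ring
  linarith

theorem sum_coeff_eq_and_defectCubic_eq_zero (hN : N ≠ 0) (t : ℝ) :
    ∑ γ, coeff N t γ = g₀ t ∧ ∑ γ, coeff N t γ * (step N * (γ : ℕ)) = g₁ t ∧
      ∀ y, defectCubic N t y = 0 := by
  obtain ⟨c, d, hcubic⟩ := defectCubic_eq N t
  obtain ⟨ha, hb, rfl, rfl⟩ := cubic_eq_zero_of_arith_prog (x := 1) (step_pos hN).ne' fun j => by
    rw [← hcubic, ← step_mul_cast hN, ← mul_add]
    exact_mod_cast defectCubic_eq_zero_of_ge (t := t) hN (k := N + j) (by omega)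
  exact ⟨by linarith, by linarith, fun y => by rw [hcubic, ha, hb]; ring⟩

theorem u_coeff_eq_gridValue (hN : N ≠ 0) (t : ℝ) (k : ℤ) :
    u N (coeff N t) ((a₁neg N t + a₁pos N t) / 2) ((a₀neg t + a₀pos N t) / 2) (step N * k) =
      gridValue N t k := by
  rw [gridValue_eq_explicitSpline_add_defectCubic hN,
    (sum_coeff_eq_and_defectCubic_eq_zero hN t).2.2, add_zero, explicitSpline]

theorem solvesSystem_coeff (hN : N ≠ 0) (t : ℝ) :
    SolvesSystem N t (coeff N t) ((a₁neg N t + a₁pos N t) / 2) ((a₀neg t + a₀pos N t) / 2) where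
  eq_f β := by
    rw [← gridValue_natCast (Nat.lt_succ_iff.1 β.2), ← u_coeff_eq_gridValue hN, Int.cast_natCast]
  eq_g₀ := (sum_coeff_eq_and_defectCubic_eq_zero hN t).1
  eq_g₁ := (sum_coeff_eq_and_defectCubic_eq_zero hN t).2.1

end ExplicitSpline

end CauchyQuad

theorem theorem1_general (N : ℕ) (hN : N ≠ 0) (t : ℝ) (ht₀ : 0 < t) (ht₁ : t < 1) :
    (∀ φ g : ℝ → ℝ, CauchyQuad.MemSobolevWith φ g →
      CauchyQuad.HasSingularIntegral φ t (CauchyQuad.singularIntegral φ t)) ∧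
    (∀ β : ℕ, β ≤ N → CauchyQuad.HasSingularIntegral
      (fun x => |x - CauchyQuad.step N * β| ^ 3) t
      (12 * CauchyQuad.f (CauchyQuad.step N * β) t)) ∧
    CauchyQuad.HasSingularIntegral (fun _ => 1) t (CauchyQuad.g₀ t) ∧
    CauchyQuad.HasSingularIntegral (fun x => x) t (CauchyQuad.g₁ t) ∧
    CauchyQuad.Δ N ≠ 0 ∧
    (∀ C : Fin (N + 1) → ℝ,
      CauchyQuad.IsSardOptimal N t C ↔ C = CauchyQuad.coeff N t) ∧
    (∀ (C : Fin (N + 1) → ℝ) (p₁ p₀ : ℝ),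
      CauchyQuad.SolvesSystem N t C p₁ p₀ ↔
        C = CauchyQuad.coeff N t ∧
        p₁ = (CauchyQuad.a₁neg N t + CauchyQuad.a₁pos N t) / 2 ∧
        p₀ = (CauchyQuad.a₀neg t + CauchyQuad.a₀pos N t) / 2) ∧
    (∀ (C : Fin (N + 1) → ℝ) (p₁ p₀ : ℝ), CauchyQuad.SolvesSystem N t C p₁ p₀ →
      (∀ k : ℤ, k ≤ 0 → CauchyQuad.u N C p₁ p₀ (CauchyQuad.step N * k) =
        -(1 / 12) * (CauchyQuad.step N * k) ^ 3 * CauchyQuad.g₀ t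
          + (1 / 4) * (CauchyQuad.step N * k) ^ 2 * CauchyQuad.g₁ t
          + CauchyQuad.a₁neg N t * (CauchyQuad.step N * k) + CauchyQuad.a₀neg t) ∧
      (∀ k : ℤ, (N : ℤ) ≤ k → CauchyQuad.u N C p₁ p₀ (CauchyQuad.step N * k) =
        (1 / 12) * (CauchyQuad.step N * k) ^ 3 * CauchyQuad.g₀ t
          - (1 / 4) * (CauchyQuad.step N * k) ^ 2 * CauchyQuad.g₁ t
          + CauchyQuad.a₁pos N t * (CauchyQuad.step N * k) + CauchyQuad.a₀pos N t)) := by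
  have hsol := CauchyQuad.solvesSystem_coeff hN t
  have hunique {C : Fin (N + 1) → ℝ} {p₁ p₀ : ℝ} (hC : CauchyQuad.SolvesSystem N t C p₁ p₀) :=
    hsol.unique hC hN ht₀ ht₁
  refine ⟨fun φ g hφ => hφ.hasSingularIntegral ht₀ ht₁, fun β hβ => ?_,
    CauchyQuad.hasSingularIntegral_one ht₀ ht₁, CauchyQuad.hasSingularIntegral_id ht₀ ht₁,
    CauchyQuad.Δ_ne_zero hN, fun C => hsol.isSardOptimal_iff hN ht₀ ht₁,
    fun C p₁ p₀ => ⟨hunique, ?_⟩, fun C p₁ p₀ hC => ?_⟩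
  · exact CauchyQuad.hasSingularIntegral_abs_cubed
      (CauchyQuad.step_mul_mem_Icc hN ⟨β, Nat.lt_succ_of_le hβ⟩) ht₀ ht₁
  · rintro ⟨rfl, rfl, rfl⟩
    exact hsol
  · obtain ⟨rfl, rfl, rfl⟩ := hunique hC
    refine ⟨fun k hk => ?_, fun k hk => ?_⟩
    · rw [CauchyQuad.u_coeff_eq_gridValue hN, CauchyQuad.gridValue_of_nonpos hk,
        CauchyQuad.leftCubic]
    · rw [CauchyQuad.u_coeff_eq_gridValue hN, CauchyQuad.gridValue_of_ge hN hk,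
        CauchyQuad.rightCubic]

theorem theorem1 (N : ℕ) (hN : 2 ≤ N) (t : ℝ) (ht₀ : 0 < t) (ht₁ : t < 1)
    (ht : ∀ β : ℕ, β ≤ N → t ≠ CauchyQuad.step N * β) :
    -- the singular integral exists on the whole space
    (∀ φ g : ℝ → ℝ, CauchyQuad.MemSobolevWith φ g →
      CauchyQuad.HasSingularIntegral φ t (CauchyQuad.singularIntegral φ t)) ∧
    -- the closed forms of the right-hand sides
    (∀ β : ℕ, β ≤ N → CauchyQuad.HasSingularIntegral
      (fun x => |x - CauchyQuad.step N * β| ^ 3) t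
      (12 * CauchyQuad.f (CauchyQuad.step N * β) t)) ∧
    CauchyQuad.HasSingularIntegral (fun _ => 1) t (CauchyQuad.g₀ t) ∧
    CauchyQuad.HasSingularIntegral (fun x => x) t (CauchyQuad.g₁ t) ∧
    -- the constants are well defined
    CauchyQuad.Δ N ≠ 0 ∧
    -- the optimal coefficients are exactly the explicit ones
    (∀ C : Fin (N + 1) → ℝ,
      CauchyQuad.IsSardOptimal N t C ↔ C = CauchyQuad.coeff N t) ∧
    -- the linear system has exactly one solution, with the explicit coefficients
    (∀ (C : Fin (N + 1) → ℝ) (p₁ p₀ : ℝ),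
      CauchyQuad.SolvesSystem N t C p₁ p₀ ↔
        C = CauchyQuad.coeff N t ∧
        p₁ = (CauchyQuad.a₁neg N t + CauchyQuad.a₁pos N t) / 2 ∧
        p₀ = (CauchyQuad.a₀neg t + CauchyQuad.a₀pos N t) / 2) ∧
    -- the constants are the coefficients of the function `u` outside `[0,1]`
    (∀ (C : Fin (N + 1) → ℝ) (p₁ p₀ : ℝ), CauchyQuad.SolvesSystem N t C p₁ p₀ →
      (∀ k : ℤ, k ≤ 0 → CauchyQuad.u N C p₁ p₀ (CauchyQuad.step N * k) =
        -(1 / 12) * (CauchyQuad.step N * k) ^ 3 * CauchyQuad.g₀ t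
          + (1 / 4) * (CauchyQuad.step N * k) ^ 2 * CauchyQuad.g₁ t
          + CauchyQuad.a₁neg N t * (CauchyQuad.step N * k) + CauchyQuad.a₀neg t) ∧
      (∀ k : ℤ, (N : ℤ) ≤ k → CauchyQuad.u N C p₁ p₀ (CauchyQuad.step N * k) =
        (1 / 12) * (CauchyQuad.step N * k) ^ 3 * CauchyQuad.g₀ t
          - (1 / 4) * (CauchyQuad.step N * k) ^ 2 * CauchyQuad.g₁ t
          + CauchyQuad.a₁pos N t * (CauchyQuad.step N * k) + CauchyQuad.a₀pos N t)) := by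
  exact theorem1_general N (by omega) t ht₀ ht₁
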